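/- Conventions. For real $\alpha$ let $k^\alpha(n)=\alpha(\alpha+1)\cdots(\alpha+n-1)/n!$ with $k^\alpha(0)=1$, i.e. $(1-z)^{-\alpha}=\sum_{n\ge 0}k^\alpha(n)z^n$ for $|z|<1$. Let $X$ be a complex Banach space and $T$ a bounded linear operator on $X$. For $\alpha\ge 0$ and $n\ge 0$ put $\Delta^{-\alpha}\mathcal T(n)=\sum_{j=0}^n k^\alpha(n-j)T^j$; $T$ is called $(C,\alpha)$-bounded if $\sup_n\|\Delta^{-\alpha}\mathcal T(n)\|/k^{\alpha+1}(n)<\infty$. For a complex sequence $f$ put $Wf(n)=f(n)-f(n+1)$, $W^{-\beta}f(n)=\sum_{j\ge n}k^\beta(j-n)f(j)$ for $\beta>0$, and $W^\alpha f=W^mW^{-(m-\alpha)}f$ with $m=[\alpha]+1$, whenever the series converge. For $0<s<1$ and $T$ $(C,\alpha)$-bounded, the bounded operator $(I-T)^s$ is defined by the functional calculus applied to $(1-z)^s=\sum_n k^{-s}(n)z^n$, that is, $$(I-T)^s=\sum_{n=0}^\infty W^\alpha k^{-s}(n)\,\Delta^{-\alpha}\mathcal T(n).$$ When $(I-T)^s$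 is injective, $(I-T)^{-s}$ denotes its inverse, a linear operator with domain $\mathrm{Ran}(I-T)^s$. Theorem. Let $0<s<1$ and $0\le\alpha<1-s$. Let $T$ be a $(C,\alpha)$-bounded operator on $X$ such that $(I-T)X$ is dense in $X$. Then $(I-T)^s$ is injective, and for every $x\in X$ the following assertions are equivalent: (i) $x\in\mathrm{Ran}(I-T)^s$; (ii) the series $\sum_{n=1}^\infty n^{s-1}T^nx$ converges in the norm of $X$; (iii) the series $\sum_{n=1}^\infty n^{s-1}T^nx$ converges weakly in $X$. If these assertions hold, then $$(I-T)^{-s}x=\sum_{n=0}^\infty k^s(n)T^nx,$$ where the series converges in norm. -/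

import Mathlib

open Filter Topology

noncomputable section

namespace CesaroBounded

/-- The Cesàro numbers `k^α(n) = α (α + 1) ⋯ (α + n - 1) / n!`, with `k^α(0) = 1`: the Taylor
coefficients of `(1 - z)^(-α)`. -/
def cesaroNumber (α : ℝ) (n : ℕ) : ℝ :=
  (∏ i ∈ Finset.range n, (α + i)) / (n.factorial : ℝ)

/-- The first order difference `W f (n) = f (n) - f (n + 1)`. -/
def diff (f : ℕ → ℂ) : ℕ → ℂ := fun n => f n - f (n + 1)

/-- The Weyl sum `W^{-β} f (n) = ∑_{j ≥ n} k^β(j - n) f(j)` of order `β`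
(written with `j = n + i`). -/
def weylSum (β : ℝ) (f : ℕ → ℂ) : ℕ → ℂ :=
  fun n => ∑' i : ℕ, (cesaroNumber β i : ℂ) * f (n + i)

/-- The Weyl difference `W^α f = W^m W^{-(m - α)} f` of order `α ≥ 0`, where `m = [α] + 1`. -/
def weylDiff (α : ℝ) (f : ℕ → ℂ) : ℕ → ℂ :=
  diff^[⌊α⌋₊ + 1] (weylSum (((⌊α⌋₊ + 1 : ℕ) : ℝ) - α) f)

variable {X : Type*} [NormedAddCommGroup X] [NormedSpace ℂ X]

/-- The Cesàro sum `Δ^{-α} 𝒯(n) = ∑_{j=0}^n k^α(n - j) T^j` of order `α`. -/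
def cesaroSum (α : ℝ) (T : X →L[ℂ] X) (n : ℕ) : X →L[ℂ] X :=
  ∑ j ∈ Finset.range (n + 1), (cesaroNumber α (n - j) : ℂ) • T ^ j

/-- The Cesàro mean `M_T^α(n) = Δ^{-α} 𝒯(n) / k^{α+1}(n)` of order `α`. -/
def cesaroMean (α : ℝ) (T : X →L[ℂ] X) (n : ℕ) : X →L[ℂ] X :=
  ((cesaroNumber (α + 1) n)⁻¹ : ℂ) • cesaroSum α T n

/-- `T` is `(C,α)`-bounded if `sup_n ‖M_T^α(n)‖ < ∞`. -/
def IsCesaroBounded (α : ℝ) (T : X →L[ℂ] X) : Prop :=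
  ∃ K : ℝ, ∀ n : ℕ, ‖cesaroMean α T n‖ ≤ K

/-- The functional calculus `f ↦ 𝔣(T) = ∑_n W^α f(n) Δ^{-α} 𝒯(n)` of a `(C,α)`-bounded operator,
for `𝔣(z) = ∑ f(n) z^n` such that `∑ |W^α f(n)| k^{α+1}(n) < ∞` (which makes the series absolutely
convergent in operator norm). -/
def calculus (α : ℝ) (T : X →L[ℂ] X) (f : ℕ → ℂ) : X →L[ℂ] X :=
  ∑' n : ℕ, weylDiff α f n • cesaroSum α T n

/-- The fractional power `(I - T)^s` for `0 < s < 1`: the functional calculus applied to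
`(1 - z)^s = ∑ k^{-s}(n) z^n`. -/
def fracPow (α : ℝ) (T : X →L[ℂ] X) (s : ℝ) : X →L[ℂ] X :=
  calculus α T (fun n => (cesaroNumber (-s) n : ℂ))

/-- `(I - T)^{-s}`, the (generally unbounded) inverse of the operator `(I - T)^s`, with domain
the range of `(I - T)^s`. It is meaningful when `(I - T)^s` is injective. -/
def negFracPow (α : ℝ) (T : X →L[ℂ] X) (s : ℝ) : X →ₗ.[ℂ] X :=
  ((fracPow α T s : X →ₗ[ℂ] X).toPMap ⊤).inverse

end CesaroBounded

end

noncomputable section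

namespace CesaroBounded

/-! Write B_N = ∑_{j<N} k^s(j) T^j (`binomialSum`). Everything rests on one fact: B_N (I-T)^s → I
strongly (`tendsto_binomialSum_fracPow_apply`). It gives injectivity and the inversion formula at
once. Conversely, if B_N x tends weakly to z, then (I-T)^s B_N x = B_N (I-T)^s x tends weakly to
(I-T)^s z and in norm to x, so x lies in the range. Replacing Γ(s) k^s(n) by n^{s-1} costs
O(n^{s-2}) per coefficient; as ‖T^n‖ = O(n^α) and α + s < 1, the error series converges absolutely
(`summable_rpow_sub_smul`).

Strong convergence follows from uniform boundedness plus convergence on the dense range of I - T. On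
that range, B_{N+1} (I-T) has coefficients k^{s-1} up to one boundary term; since ‖T^j (I-T)^s‖ =
O(j^α), the resulting series converges in operator norm, to I - T.

The uniform bound is the hard part. B_N (I-T)^s is the calculus at f = `truncCoeff s N`, so ∑ |W^α
f(n)| k^{α+1}(n) must be bounded independently of N. Now f is 1 at 0, vanishes on 0 < m < N, is
nonpositive from N on and has nonnegative partial sums, and W^α f(n) ≤ 0 for n ≥ N. Since k^{α+1}
pairs with W^α f to give ∑ f, the negative tail cannot outweigh the head n < N
(`sum_abs_weylDiffReal_mul_le`). The head is estimated from the closed form of f; the remaining sum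
is controlled by the same positivity with s + α < 1 in place of s (`sum_cesaroNumber_div_le`). -/

/-! ### Cesàro numbers: recurrences, signs and convolution identities. -/

@[simp] theorem cesaroNumber_zero (a : ℝ) : cesaroNumber a 0 = 1 := by simp [cesaroNumber]

theorem succ_mul_cesaroNumber (a : ℝ) (n : ℕ) :
    ((n : ℝ) + 1) * cesaroNumber a (n + 1) = (a + n) * cesaroNumber a n := by
  simp only [cesaroNumber, Finset.prod_range_succ, Nat.factorial_succ]
  push_cast
  have : (n.factorial : ℝ) ≠ 0 := by positivity
  have : (n : ℝ) + 1 ≠ 0 := by positivity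
  field_simp

theorem succ_mul_cesaroNumber_shift (a : ℝ) (n : ℕ) :
    ((n : ℝ) + 1) * cesaroNumber a (n + 1) = a * cesaroNumber (a + 1) n := by
  simp only [cesaroNumber, Finset.prod_range_succ', Nat.factorial_succ]
  push_cast
  have : (n.factorial : ℝ) ≠ 0 := by positivity
  have : (n : ℝ) + 1 ≠ 0 := by positivity
  have h : ∀ i : ℕ, a + ((i : ℝ) + 1) = a + 1 + i := fun i => by ring
  simp only [h]
  field_simp
  ring

theorem cesaroNumber_one_right (a : ℝ) : cesaroNumber a 1 = a := by simp [cesaroNumber]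

theorem cesaroNumber_add_one_succ (a : ℝ) (n : ℕ) :
    cesaroNumber (a + 1) (n + 1) = cesaroNumber (a + 1) n + cesaroNumber a (n + 1) := by
  have h1 := succ_mul_cesaroNumber (a + 1) n
  have h2 := succ_mul_cesaroNumber_shift a n
  have h : (n : ℝ) + 1 ≠ 0 := by positivity
  apply mul_left_cancel₀ h
  linear_combination h1 - h2

theorem sum_cesaroNumber (a : ℝ) (n : ℕ) :
    ∑ j ∈ Finset.range (n + 1), cesaroNumber a j = cesaroNumber (a + 1) n := by
  induction n with
  | zero => simp
  | succ n ih => rw [Finset.sum_range_succ, ih, cesaroNumber_add_one_succ]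

theorem cesaroNumber_pos {a : ℝ} (ha : 0 < a) (n : ℕ) : 0 < cesaroNumber a n := by
  unfold cesaroNumber
  have : 0 < ∏ i ∈ Finset.range n, (a + i) := Finset.prod_pos fun i _ => by positivity
  positivity

theorem cesaroNumber_nonneg {a : ℝ} (ha : 0 ≤ a) (n : ℕ) : 0 ≤ cesaroNumber a n := by
  unfold cesaroNumber
  have : 0 ≤ ∏ i ∈ Finset.range n, (a + i) := Finset.prod_nonneg fun i _ => by positivity
  positivity

theorem cesaroNumber_neg_succ_nonpos {a : ℝ} (h0 : 0 ≤ a) (h1 : a ≤ 1) (n : ℕ) :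
    cesaroNumber (-a) (n + 1) ≤ 0 := by
  have h := succ_mul_cesaroNumber_shift (-a) n
  have h2 : 0 ≤ cesaroNumber (-a + 1) n := cesaroNumber_nonneg (by linarith) n
  have h3 : 0 < (n : ℝ) + 1 := by positivity
  by_contra hc
  push Not at hc
  nlinarith [mul_pos h3 hc, mul_nonneg h0 h2]

theorem cesaroNumber_neg_nonpos {a : ℝ} (h0 : 0 ≤ a) (h1 : a ≤ 1) {n : ℕ} (hn : n ≠ 0) :
    cesaroNumber (-a) n ≤ 0 := by
  obtain ⟨m, rfl⟩ := Nat.exists_eq_succ_of_ne_zero hn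
  exact cesaroNumber_neg_succ_nonpos h0 h1 m

theorem monotone_cesaroNumber_add_one {a : ℝ} (ha : 0 ≤ a) :
    Monotone (cesaroNumber (a + 1)) := by
  refine monotone_nat_of_le_succ fun n => ?_
  rw [cesaroNumber_add_one_succ]
  linarith [cesaroNumber_nonneg ha (n + 1)]

theorem antitone_cesaroNumber_one_sub {a : ℝ} (h0 : 0 ≤ a) (h1 : a ≤ 1) :
    Antitone (cesaroNumber (1 - a)) := by
  refine antitone_nat_of_succ_le fun n => ?_
  have := cesaroNumber_add_one_succ (-a) n
  rw [show -a + 1 = 1 - a by ring] at this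
  linarith [cesaroNumber_neg_succ_nonpos h0 h1 n]

theorem cesaroNumber_one_sub_le_one {a : ℝ} (h0 : 0 ≤ a) (h1 : a ≤ 1) (n : ℕ) :
    cesaroNumber (1 - a) n ≤ 1 := by
  simpa using antitone_cesaroNumber_one_sub h0 h1 (Nat.zero_le n)

theorem cesaroNumber_le_one {a : ℝ} (h0 : 0 ≤ a) (h1 : a ≤ 1) (n : ℕ) :
    cesaroNumber a n ≤ 1 := by
  simpa using cesaroNumber_one_sub_le_one (a := 1 - a) (by linarith) (by linarith) n

theorem cesaroNumber_neg_succ_le_succ_succ {a : ℝ} (h0 : 0 ≤ a) (h1 : a ≤ 1) (n : ℕ) :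
    cesaroNumber (-a) (n + 1) ≤ cesaroNumber (-a) (n + 2) := by
  have h := succ_mul_cesaroNumber (-a) (n + 1)
  push_cast at h
  have h2 := cesaroNumber_neg_succ_nonpos h0 h1 n
  have h3 : 0 < (n : ℝ) + 1 + 1 := by positivity
  refine le_of_mul_le_mul_left ?_ h3
  rw [h]
  nlinarith

theorem cesaroNumber_neg_mono {a : ℝ} (h0 : 0 ≤ a) (h1 : a ≤ 1) {m n : ℕ} (hm : m ≠ 0)
    (hmn : m ≤ n) : cesaroNumber (-a) m ≤ cesaroNumber (-a) n := by
  obtain ⟨m, rfl⟩ := Nat.exists_eq_succ_of_ne_zero hm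
  obtain ⟨n, rfl⟩ := Nat.exists_eq_succ_of_ne_zero (by omega : n ≠ 0)
  exact monotone_nat_of_le_succ (f := fun n => cesaroNumber (-a) (n + 1))
    (fun n => cesaroNumber_neg_succ_le_succ_succ h0 h1 n) (by omega : m ≤ n)

/-- Partial sums of the convolution of `k^a` and `k^{-a}`. -/
theorem mul_sum_cesaroNumber_mul (a : ℝ) {N m : ℕ} (hN : N ≤ m) :
    (m : ℝ) * ∑ j ∈ Finset.range N, cesaroNumber a j * cesaroNumber (-a) (m - j) =
      -(N * cesaroNumber a N * cesaroNumber (1 - a) (m - N)) := by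
  induction N with
  | zero => simp
  | succ N ih =>
    rw [Finset.sum_range_succ, mul_add, ih (by omega)]
    obtain ⟨d, rfl⟩ := Nat.exists_eq_add_of_le hN
    have e1 : N + 1 + d - N = d + 1 := by omega
    have e2 : N + 1 + d - (N + 1) = d := by omega
    rw [e1, e2]
    have h1 := succ_mul_cesaroNumber a N
    have h2 := succ_mul_cesaroNumber_shift (-a) d
    have h3 := succ_mul_cesaroNumber (1 - a) d
    rw [show -a + 1 = 1 - a by ring] at h2
    have hd : (d : ℝ) + 1 ≠ 0 := by positivity
    push_cast
    apply mul_left_cancel₀ hd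
    linear_combination (N + 1 + d) * cesaroNumber a N * h2 -
      N * cesaroNumber a N * h3 + (d + 1) * cesaroNumber (1 - a) d * h1

theorem sum_cesaroNumber_mul_neg (a : ℝ) (m : ℕ) :
    ∑ j ∈ Finset.range (m + 1), cesaroNumber a j * cesaroNumber (-a) (m - j) =
      if m = 0 then 1 else 0 := by
  rcases eq_or_ne m 0 with rfl | hm
  · simp
  rw [if_neg hm]
  have hm' : (m : ℝ) ≠ 0 := by exact_mod_cast hm
  apply mul_left_cancel₀ hm'
  rw [Finset.sum_range_succ, mul_add, mul_sum_cesaroNumber_mul a le_rfl]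
  simp

/-- The convolution of two sequences. -/
def conv (f g : ℕ → ℝ) (n : ℕ) : ℝ := ∑ j ∈ Finset.range (n + 1), f j * g (n - j)

theorem conv_eq_coeff (f g : ℕ → ℝ) (n : ℕ) :
    conv f g n = PowerSeries.coeff n (PowerSeries.mk f * PowerSeries.mk g) := by
  rw [PowerSeries.coeff_mul, Finset.Nat.sum_antidiagonal_eq_sum_range_succ_mk]
  simp [conv]

theorem mk_cesaroNumber_mul_neg (a : ℝ) :
    PowerSeries.mk (cesaroNumber a) * PowerSeries.mk (cesaroNumber (-a)) = 1 := by
  ext n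
  rw [← conv_eq_coeff, conv, sum_cesaroNumber_mul_neg, PowerSeries.coeff_one]

theorem one_sub_X_mul_mk_cesaroNumber (a : ℝ) :
    (1 - PowerSeries.X) * PowerSeries.mk (cesaroNumber (a + 1)) =
      PowerSeries.mk (cesaroNumber a) := by
  ext n
  cases n with
  | zero => simp [sub_mul]
  | succ n => simp [sub_mul, PowerSeries.coeff_succ_X_mul, cesaroNumber_add_one_succ]

/-- Coefficients of (1-z)^{-(a+1)} (1-z)^a = 1/(1-z). -/
theorem conv_cesaroNumber_neg_add_one (a : ℝ) (n : ℕ) :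
    conv (cesaroNumber (a + 1)) (cesaroNumber (-a)) n = 1 := by
  have h1 := one_sub_X_mul_mk_cesaroNumber a
  have h2 := mk_cesaroNumber_mul_neg a
  have h3 := one_sub_X_mul_mk_cesaroNumber 0
  have h4 : PowerSeries.mk (cesaroNumber 0) = 1 := by
    ext n
    cases n with
    | zero => simp
    | succ n => simp [cesaroNumber, Finset.prod_range_succ', PowerSeries.coeff_one]
  have h5 : PowerSeries.mk (cesaroNumber (0 + 1)) = PowerSeries.mk (fun _ => (1 : ℝ)) := by
    ext n
    simp [cesaroNumber]
    rw [div_eq_one_iff_eq (by positivity), Nat.factorial_eq_prod_range_add_one]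
    push_cast
    exact Finset.prod_congr rfl fun i _ => by ring
  rw [conv_eq_coeff]
  have : PowerSeries.mk (cesaroNumber (a + 1)) * PowerSeries.mk (cesaroNumber (-a)) =
      PowerSeries.mk (fun _ => (1 : ℝ)) := by
    rw [← h5]
    rw [← h1] at h2
    linear_combination (PowerSeries.mk (cesaroNumber (0 + 1))) * h2 -
      (PowerSeries.mk (cesaroNumber (a + 1)) * PowerSeries.mk (cesaroNumber (-a))) * (h3.trans h4)
  simp [this]

/-- Coefficients of (1-z)^{1-a} (1-z)^a = 1 - z. -/
theorem conv_cesaroNumber_sub_one_neg (a : ℝ) (n : ℕ) :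
    conv (cesaroNumber (a - 1)) (cesaroNumber (-a)) n =
      if n = 0 then 1 else if n = 1 then -1 else 0 := by
  have h1 := one_sub_X_mul_mk_cesaroNumber (a - 1)
  rw [sub_add_cancel] at h1
  rw [conv_eq_coeff, ← h1, mul_assoc, mk_cesaroNumber_mul_neg, mul_one, map_sub,
    PowerSeries.coeff_one, PowerSeries.coeff_X]
  rcases n with _ | _ | n <;> simp

/-- Only the term k^{-a}(0) = 1 is positive, and the partial sums k^{1-a} are nonnegative, so the
negative terms total at most 1 in absolute value. -/
theorem sum_abs_cesaroNumber_neg_le {a : ℝ} (h0 : 0 ≤ a) (h1 : a ≤ 1) (n : ℕ) :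
    ∑ j ∈ Finset.range n, |cesaroNumber (-a) j| ≤ 2 := by
  rcases n with _ | n
  · simp
  have h := sum_cesaroNumber (-a) n
  have h2 : 0 ≤ cesaroNumber (-a + 1) n := cesaroNumber_nonneg (by linarith) n
  rw [Finset.sum_range_succ'] at h ⊢
  have : ∑ j ∈ Finset.range n, |cesaroNumber (-a) (j + 1)| =
      -∑ j ∈ Finset.range n, cesaroNumber (-a) (j + 1) := by
    rw [← Finset.sum_neg_distrib]
    exact Finset.sum_congr rfl fun j _ =>
      abs_of_nonpos (cesaroNumber_neg_succ_nonpos h0 h1 j)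
  rw [this]
  simp only [cesaroNumber_zero, abs_one] at h ⊢
  linarith

theorem summable_abs_cesaroNumber_neg {a : ℝ} (h0 : 0 ≤ a) (h1 : a ≤ 1) :
    Summable fun n => |cesaroNumber (-a) n| :=
  summable_of_sum_range_le (fun _ => abs_nonneg _) (sum_abs_cesaroNumber_neg_le h0 h1)

theorem summable_cesaroNumber_neg {a : ℝ} (h0 : 0 ≤ a) (h1 : a ≤ 1) :
    Summable (cesaroNumber (-a)) :=
  (summable_abs_cesaroNumber_neg h0 h1).of_abs

theorem abs_cesaroNumber_neg_le_one {a : ℝ} (h0 : 0 ≤ a) (h1 : a ≤ 1) (n : ℕ) :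
    |cesaroNumber (-a) n| ≤ 1 := by
  rcases n with _ | n
  · simp
  have h := cesaroNumber_add_one_succ (-a) n
  rw [show -a + 1 = 1 - a by ring] at h
  rw [abs_of_nonpos (cesaroNumber_neg_succ_nonpos h0 h1 n)]
  have := cesaroNumber_one_sub_le_one h0 h1 n
  have := cesaroNumber_nonneg (a := 1 - a) (by linarith) (n + 1)
  linarith

/-! ### Asymptotics -/

/-- Gauss's limit formula for Γ, inverted. -/
theorem tendsto_cesaroNumber_mul_rpow (a : ℝ) :
    Tendsto (fun n : ℕ => cesaroNumber a n * (n : ℝ) ^ (1 - a)) atTop (𝓝 (Real.Gamma a)⁻¹) := by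
  by_cases hz : ∃ m : ℕ, a = -m
  · obtain ⟨m, rfl⟩ := hz
    -- At a pole `Real.Gamma` takes the value 0, so its inverse is 0, the true value of 1/Γ; the
    -- product defining k^a(n) has a zero factor once n > m.
    rw [Real.Gamma_neg_nat_eq_zero, inv_zero]
    refine tendsto_const_nhds.congr' ?_
    filter_upwards [eventually_gt_atTop m] with n hn
    have : ∏ i ∈ Finset.range n, (-(m : ℝ) + i) = 0 :=
      Finset.prod_eq_zero (Finset.mem_range.2 hn) (by simp)
    simp [cesaroNumber, this]
  push Not at hz
  have hG : Real.Gamma a ≠ 0 := Real.Gamma_ne_zero hz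
  have h1 := (Real.GammaSeq_tendsto_Gamma a).inv₀ hG
  have h2 : Tendsto (fun n : ℕ => (n : ℝ) / (n + a)) atTop (𝓝 1) :=
    tendsto_natCast_div_add_atTop a
  have h3 := h1.mul h2
  rw [mul_one] at h3
  refine h3.congr' ?_
  filter_upwards [eventually_gt_atTop 0] with n hn
  have hn' : (0 : ℝ) < n := by exact_mod_cast hn
  have hna : (n : ℝ) + a ≠ 0 := fun h => hz n (by linarith)
  have hf : (n.factorial : ℝ) ≠ 0 := by positivity
  have hp : (n : ℝ) ^ a ≠ 0 := (Real.rpow_pos_of_pos hn' a).ne'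
  rw [Real.GammaSeq, cesaroNumber, Finset.prod_range_succ, Real.rpow_sub hn', Real.rpow_one]
  have hna' : a + (n : ℝ) ≠ 0 := by rwa [add_comm]
  rw [inv_div, add_comm (n : ℝ) a]
  field_simp

/-- `k^a(n) k^b(n) / k^c(n)` is bounded when `a + b = c + 1`. -/
theorem exists_cesaroNumber_mul_le {a b c : ℝ} (hc : 0 < c) (h : a + b = c + 1) :
    ∃ C : ℝ, ∀ n, cesaroNumber a n * cesaroNumber b n ≤ C * cesaroNumber c n := by
  have hG : (Real.Gamma c)⁻¹ ≠ 0 := inv_ne_zero (Real.Gamma_pos_of_pos hc).ne'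
  have ht := ((tendsto_cesaroNumber_mul_rpow a).mul (tendsto_cesaroNumber_mul_rpow b)).div
    (tendsto_cesaroNumber_mul_rpow c) hG
  have ht2 : Tendsto (fun n => cesaroNumber a n * cesaroNumber b n / cesaroNumber c n) atTop
      (𝓝 ((Real.Gamma a)⁻¹ * (Real.Gamma b)⁻¹ / (Real.Gamma c)⁻¹)) := by
    refine ht.congr' ?_
    filter_upwards [eventually_gt_atTop 0] with n hn
    have hn' : (0 : ℝ) < n := by exact_mod_cast hn
    have hp : (n : ℝ) ^ (1 - c) ≠ 0 := (Real.rpow_pos_of_pos hn' _).ne'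
    have hk := (cesaroNumber_pos hc n).ne'
    simp only [Pi.div_apply]
    have : (n : ℝ) ^ (1 - c) = (n : ℝ) ^ (1 - a) * (n : ℝ) ^ (1 - b) := by
      rw [← Real.rpow_add hn']; congr 1; linarith
    rw [div_eq_div_iff (mul_ne_zero hk hp) hk, this]
    ring
  obtain ⟨C, hC⟩ := ht2.bddAbove_range
  refine ⟨C, fun n => ?_⟩
  have := hC ⟨n, rfl⟩
  rwa [div_le_iff₀ (cesaroNumber_pos hc n)] at this

theorem exists_abs_cesaroNumber_le (a : ℝ) :
    ∃ C : ℝ, 0 ≤ C ∧ ∀ n : ℕ, 0 < n → |cesaroNumber a n| ≤ C * (n : ℝ) ^ (a - 1) := by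
  obtain ⟨C, hC⟩ := (tendsto_cesaroNumber_mul_rpow a).abs.bddAbove_range
  refine ⟨C, (abs_nonneg _).trans (hC ⟨0, rfl⟩), fun n hn => ?_⟩
  have hn' : (0 : ℝ) < n := by exact_mod_cast hn
  have := hC ⟨n, rfl⟩
  simp only [abs_mul, abs_of_pos (Real.rpow_pos_of_pos hn' (1 - a))] at this
  rwa [show a - 1 = -(1 - a) by ring, Real.rpow_neg hn'.le, ← div_eq_mul_inv,
    le_div_iff₀ (Real.rpow_pos_of_pos hn' _)]

theorem summable_cesaroNumber_mul {a b : ℝ} (h : a + b < 1) :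
    Summable fun n => |cesaroNumber a n| * |cesaroNumber b n| := by
  obtain ⟨C, hC0, hC⟩ := exists_abs_cesaroNumber_le a
  obtain ⟨D, hD0, hD⟩ := exists_abs_cesaroNumber_le b
  have hs : Summable fun n : ℕ => C * D * (n : ℝ) ^ (a + b - 2) :=
    (Real.summable_nat_rpow.2 (by linarith)).mul_left _
  refine Summable.of_norm_bounded_eventually_nat hs ?_
  filter_upwards [eventually_gt_atTop 0] with n hn
  have hn' : (0 : ℝ) < n := by exact_mod_cast hn
  rw [Real.norm_of_nonneg (by positivity)]
  calc _ ≤ (C * (n : ℝ) ^ (a - 1)) * (D * (n : ℝ) ^ (b - 1)) := by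
        gcongr
        · exact hC n hn
        · exact hD n hn
    _ = _ := by
        rw [show a + b - 2 = (a - 1) + (b - 1) by ring, Real.rpow_add hn']; ring

theorem tendsto_cesaroNumber_mul_zero {a b : ℝ} (h : a + b < 2) :
    Tendsto (fun n => |cesaroNumber a n| * |cesaroNumber b n|) atTop (𝓝 0) := by
  obtain ⟨C, hC0, hC⟩ := exists_abs_cesaroNumber_le a
  obtain ⟨D, hD0, hD⟩ := exists_abs_cesaroNumber_le b
  have hs : Tendsto (fun n : ℕ => C * D * (n : ℝ) ^ (-(2 - a - b))) atTop (𝓝 (C * D * 0)) :=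
    ((tendsto_rpow_neg_atTop (by linarith)).comp tendsto_natCast_atTop_atTop).const_mul _
  rw [mul_zero] at hs
  refine squeeze_zero' (Eventually.of_forall fun n => by positivity) ?_ hs
  filter_upwards [eventually_gt_atTop 0] with n hn
  have hn' : (0 : ℝ) < n := by exact_mod_cast hn
  calc _ ≤ (C * (n : ℝ) ^ (a - 1)) * (D * (n : ℝ) ^ (b - 1)) := by
        gcongr
        · exact hC n hn
        · exact hD n hn
    _ = _ := by
        rw [show -(2 - a - b) = (a - 1) + (b - 1) by ring, Real.rpow_add hn']; ring

theorem Gamma_mul_cesaroNumber {a : ℝ} (ha : 0 < a) (n : ℕ) :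
    Real.Gamma a * cesaroNumber a n = Real.Gamma (n + a) / n.factorial := by
  induction n with
  | zero => simp
  | succ n ih =>
    have h := succ_mul_cesaroNumber a n
    have hn : (n : ℝ) + 1 ≠ 0 := by positivity
    have hf : (n.factorial : ℝ) ≠ 0 := by positivity
    rw [Nat.factorial_succ]
    push_cast
    rw [show (n : ℝ) + 1 + a = (n + a) + 1 by ring, Real.Gamma_add_one (by positivity)]
    rw [eq_div_iff hf] at ih
    rw [eq_div_iff (mul_ne_zero hn hf)]
    linear_combination Real.Gamma a * n.factorial * h + (n + a) * ih

/-- Log-convexity of Γ at n + s = (1-s) n + s (n+1). -/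
theorem Gamma_mul_cesaroNumber_le {s : ℝ} (h0 : 0 < s) (h1 : s < 1) {n : ℕ} (hn : 0 < n) :
    Real.Gamma s * cesaroNumber s n ≤ (n : ℝ) ^ (s - 1) := by
  have hn' : (0 : ℝ) < n := by exact_mod_cast hn
  have hG := Real.Gamma_pos_of_pos hn'
  rw [Gamma_mul_cesaroNumber h0, ← Real.Gamma_nat_eq_factorial, Real.Gamma_add_one hn'.ne']
  have h := Real.Gamma_mul_add_mul_le_rpow_Gamma_mul_rpow_Gamma hn'
    (by positivity : (0 : ℝ) < n + 1) (by linarith : 0 < 1 - s) h0 (by ring)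
  rw [show (1 - s) * (n : ℝ) + s * (n + 1) = n + s by ring, Real.Gamma_add_one hn'.ne',
    Real.mul_rpow hn'.le hG.le] at h
  have e : Real.Gamma n ^ (1 - s) * Real.Gamma n ^ s = Real.Gamma n := by
    rw [← Real.rpow_add hG]; simp
  rw [div_le_iff₀ (by positivity), Real.rpow_sub_one hn'.ne']
  calc _ ≤ _ := h
    _ = (n : ℝ) ^ s * (Real.Gamma n ^ (1 - s) * Real.Gamma n ^ s) := by ring
    _ = _ := by rw [e]; field_simp

/-- Log-convexity of Γ at n + 1 = s (n+s) + (1-s) (n+s+1). -/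
theorem le_Gamma_mul_cesaroNumber {s : ℝ} (h0 : 0 < s) (h1 : s < 1) {n : ℕ} (hn : 0 < n) :
    ((n : ℝ) + s) ^ (s - 1) ≤ Real.Gamma s * cesaroNumber s n := by
  have hn' : (0 : ℝ) < n := by exact_mod_cast hn
  have hns : (0 : ℝ) < n + s := by positivity
  have hG := Real.Gamma_pos_of_pos hns
  rw [Gamma_mul_cesaroNumber h0, ← Real.Gamma_nat_eq_factorial]
  have hG2 : 0 < Real.Gamma (n + 1) := Real.Gamma_pos_of_pos (by positivity)
  have h := Real.Gamma_mul_add_mul_le_rpow_Gamma_mul_rpow_Gamma hns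
    (by positivity : (0 : ℝ) < n + s + 1) h0 (by linarith : 0 < 1 - s) (by ring)
  rw [show s * ((n : ℝ) + s) + (1 - s) * (n + s + 1) = n + 1 by ring,
    Real.Gamma_add_one hns.ne', Real.mul_rpow hns.le hG.le] at h
  have e : Real.Gamma (n + s) ^ s * Real.Gamma (n + s) ^ (1 - s) = Real.Gamma (n + s) := by
    rw [← Real.rpow_add hG]; simp
  have e2 : ((n : ℝ) + s) ^ (s - 1) * (n + s) ^ (1 - s) = 1 := by
    rw [← Real.rpow_add hns]; simp
  rw [le_div_iff₀ hG2]
  calc _ ≤ _ := mul_le_mul_of_nonneg_left h (by positivity)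
    _ = (((n : ℝ) + s) ^ (s - 1) * (n + s) ^ (1 - s)) *
        (Real.Gamma (n + s) ^ s * Real.Gamma (n + s) ^ (1 - s)) := by ring
    _ = _ := by rw [e, e2, one_mul]

theorem abs_rpow_sub_Gamma_mul_cesaroNumber_le {s : ℝ} (h0 : 0 < s) (h1 : s < 1) {n : ℕ}
    (hn : 0 < n) :
    |(n : ℝ) ^ (s - 1) - Real.Gamma s * cesaroNumber s n| ≤ (n : ℝ) ^ (s - 2) := by
  have hn' : (0 : ℝ) < n := by exact_mod_cast hn
  have hns : (0 : ℝ) < n + s := by positivity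
  have h2 := le_Gamma_mul_cesaroNumber h0 h1 hn
  rw [abs_of_nonneg (sub_nonneg.2 (Gamma_mul_cesaroNumber_le h0 h1 hn))]
  have hq : (n : ℝ) / (n + s) ≤ ((n : ℝ) / (n + s)) ^ (1 - s) := by
    apply Real.self_le_rpow_of_le_one (by positivity)
    · rw [div_le_one hns]; linarith
    · linarith
  have hpos := Real.rpow_pos_of_pos hn' (s - 1)
  have e : ((n : ℝ) + s) ^ (s - 1) = (n : ℝ) ^ (s - 1) * ((n : ℝ) / (n + s)) ^ (1 - s) := by
    rw [Real.div_rpow hn'.le hns.le, show (1 - s) = -(s - 1) by ring, Real.rpow_neg hn'.le,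
      Real.rpow_neg hns.le]
    have := (Real.rpow_pos_of_pos hns (s - 1)).ne'
    field_simp
  have e3 : (n : ℝ) ^ (s - 2) = (n : ℝ) ^ (s - 1) * (1 / n) := by
    rw [show s - 2 = (s - 1) - 1 by ring, Real.rpow_sub_one hn'.ne' (s - 1)]; ring
  have h5 : 1 - (n : ℝ) / (n + s) ≤ 1 / n := by
    rw [sub_le_iff_le_add, div_add_div _ _ hn'.ne' hns.ne', le_div_iff₀ (by positivity)]
    nlinarith
  calc _ ≤ (n : ℝ) ^ (s - 1) - (n : ℝ) ^ (s - 1) * ((n : ℝ) / (n + s)) := by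
        rw [e] at h2
        nlinarith
    _ = (n : ℝ) ^ (s - 1) * (1 - (n : ℝ) / (n + s)) := by ring
    _ ≤ _ := by rw [e3]; exact mul_le_mul_of_nonneg_left h5 hpos.le

/-! ### Weyl differences of real sequences and the sign argument. -/

/-- The sequence `k^{-a}` delayed by `j` steps. -/
def delayed (a : ℝ) (j m : ℕ) : ℝ := if j ≤ m then cesaroNumber (-a) (m - j) else 0

/-- The Weyl difference `W^α f` of a real summable sequence, in the form
`∑_{m ≥ n} k^{-α}(m - n) f(m)`. -/
def weylDiffReal (α : ℝ) (f : ℕ → ℝ) (n : ℕ) : ℝ := ∑' m, delayed α n m * f m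

theorem delayed_of_lt (a : ℝ) {j m : ℕ} (h : m < j) : delayed a j m = 0 := by
  simp [delayed, h]

theorem delayed_add (a : ℝ) (j i : ℕ) : delayed a j (j + i) = cesaroNumber (-a) i := by
  simp [delayed]

@[simp] theorem delayed_self (a : ℝ) (j : ℕ) : delayed a j j = 1 := by
  simp [delayed]

theorem delayed_succ_succ (a : ℝ) (j m : ℕ) : delayed a (j + 1) (m + 1) = delayed a j m := by
  simp [delayed]

theorem delayed_nonpos {a : ℝ} (h0 : 0 ≤ a) (h1 : a ≤ 1) {j m : ℕ} (h : m ≠ j) :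
    delayed a j m ≤ 0 := by
  unfold delayed
  split_ifs with hj
  · exact cesaroNumber_neg_nonpos h0 h1 (by omega)
  · rfl

theorem abs_delayed_le_one {a : ℝ} (h0 : 0 ≤ a) (h1 : a ≤ 1) (j m : ℕ) : |delayed a j m| ≤ 1 := by
  unfold delayed
  split_ifs with hj
  · exact abs_cesaroNumber_neg_le_one h0 h1 _
  · simp

theorem support_delayed_mul_subset (a : ℝ) (f : ℕ → ℝ) (n : ℕ) :
    (Function.support fun m => delayed a n m * f m) ⊆ Set.range fun i : ℕ => n + i := by
  intro m hm
  by_contra hc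
  refine hm ?_
  have : m < n := by
    by_contra h
    exact hc ⟨m - n, by simp; omega⟩
  simp [delayed_of_lt a this]

theorem weylDiffReal_eq_tsum (α : ℝ) (f : ℕ → ℝ) (n : ℕ) :
    weylDiffReal α f n = ∑' i, cesaroNumber (-α) i * f (n + i) := by
  rw [weylDiffReal, ← (add_right_injective n).tsum_eq (support_delayed_mul_subset α f n)]
  simp [delayed_add]

theorem sum_abs_delayed_right_le {a : ℝ} (h0 : 0 ≤ a) (h1 : a ≤ 1) (j M : ℕ) :
    ∑ m ∈ Finset.range M, |delayed a j m| ≤ 2 := by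
  calc ∑ m ∈ Finset.range M, |delayed a j m| ≤ ∑ m ∈ Finset.range (j + M), |delayed a j m| :=
        Finset.sum_le_sum_of_subset_of_nonneg (Finset.range_mono (by omega))
          fun _ _ _ => abs_nonneg _
    _ = ∑ i ∈ Finset.range M, |cesaroNumber (-a) i| := by
        rw [Finset.sum_range_add, Finset.sum_eq_zero, zero_add]
        · simp [delayed_add]
        · intro m hm
          simp [delayed_of_lt a (Finset.mem_range.1 hm)]
    _ ≤ 2 := sum_abs_cesaroNumber_neg_le h0 h1 M

theorem sum_abs_delayed_left_le {a : ℝ} (h0 : 0 ≤ a) (h1 : a ≤ 1) (N m : ℕ) :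
    ∑ n ∈ Finset.range N, |delayed a n m| ≤ 2 := by
  calc ∑ n ∈ Finset.range N, |delayed a n m| ≤
        ∑ n ∈ Finset.range (m + 1 + N), |delayed a n m| :=
        Finset.sum_le_sum_of_subset_of_nonneg (Finset.range_mono (by omega))
          fun _ _ _ => abs_nonneg _
    _ = ∑ n ∈ Finset.range (m + 1), |delayed a n m| := by
        rw [Finset.sum_range_add, add_eq_left]
        exact Finset.sum_eq_zero fun n _ => by rw [delayed_of_lt a (by omega), abs_zero]
    _ = ∑ i ∈ Finset.range (m + 1), |cesaroNumber (-a) i| := by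
        rw [← Finset.sum_range_reflect]
        refine Finset.sum_congr rfl fun i hi => ?_
        have := Finset.mem_range.1 hi
        rw [delayed, if_pos (by omega)]
        congr 2
        omega
    _ ≤ 2 := sum_abs_cesaroNumber_neg_le h0 h1 _

theorem summable_abs_delayed {a : ℝ} (h0 : 0 ≤ a) (h1 : a ≤ 1) (j : ℕ) :
    Summable fun m => |delayed a j m| :=
  summable_of_sum_range_le (fun _ => abs_nonneg _) (sum_abs_delayed_right_le h0 h1 j)

theorem summable_delayed {a : ℝ} (h0 : 0 ≤ a) (h1 : a ≤ 1) (j : ℕ) : Summable (delayed a j) :=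
  (summable_abs_delayed h0 h1 j).of_abs

theorem sum_delayed_nonneg {a : ℝ} (h1 : a ≤ 1) (j M : ℕ) :
    0 ≤ ∑ m ∈ Finset.range M, delayed a j m := by
  rcases le_or_gt M j with h | h
  · rw [Finset.sum_eq_zero fun m hm => delayed_of_lt a
      (lt_of_lt_of_le (Finset.mem_range.1 hm) h)]
  · obtain ⟨d, rfl⟩ := Nat.exists_eq_add_of_lt h
    rw [add_assoc, Finset.sum_range_add, Finset.sum_eq_zero fun m hm => delayed_of_lt a
      (Finset.mem_range.1 hm), zero_add]
    simp only [delayed_add]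
    rw [sum_cesaroNumber]
    exact cesaroNumber_nonneg (by linarith) _

theorem tsum_delayed_nonneg {a : ℝ} (h0 : 0 ≤ a) (h1 : a ≤ 1) (j : ℕ) :
    0 ≤ ∑' m, delayed a j m :=
  ge_of_tendsto' (summable_delayed h0 h1 j).hasSum.tendsto_sum_nat
    fun M => sum_delayed_nonneg h1 j M

theorem summable_delayed_mul {α : ℝ} (h0 : 0 ≤ α) (h1 : α ≤ 1) {f : ℕ → ℝ} (hf : Summable f)
    (n : ℕ) : Summable fun m => delayed α n m * f m := by
  refine Summable.of_norm_bounded hf.abs fun m => ?_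
  rw [Real.norm_eq_abs, abs_mul]
  exact mul_le_of_le_one_left (abs_nonneg _) (abs_delayed_le_one h0 h1 n m)

/-- Only the weight at m = n is positive, so replacing f(m) by the smaller f(n) for m > n increases
the sum; what results is f(n) times a nonnegative total weight. -/
theorem weylDiffReal_nonpos {α : ℝ} (h0 : 0 ≤ α) (h1 : α ≤ 1) {f : ℕ → ℝ} (hf : Summable f)
    {n : ℕ} (hn : f n ≤ 0) (hmono : ∀ m, n ≤ m → f n ≤ f m) : weylDiffReal α f n ≤ 0 := by
  have h : weylDiffReal α f n ≤ ∑' m, delayed α n m * f n := by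
    refine (summable_delayed_mul h0 h1 hf n).tsum_le_tsum (fun m => ?_)
      ((summable_delayed h0 h1 n).mul_right _)
    rcases lt_trichotomy m n with h | rfl | h
    · simp [delayed_of_lt α h]
    · rfl
    · exact mul_le_mul_of_nonpos_left (hmono m h.le) (delayed_nonpos h0 h1 h.ne')
  rw [tsum_mul_right] at h
  exact h.trans (mul_nonpos_of_nonneg_of_nonpos (tsum_delayed_nonneg h0 h1 n) hn)

theorem weylDiffReal_delayed_nonpos {α s : ℝ} (h0 : 0 ≤ α) (h1 : α ≤ 1) (hs0 : 0 ≤ s)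
    (hs1 : s ≤ 1) {j n : ℕ} (h : j < n) : weylDiffReal α (delayed s j) n ≤ 0 := by
  refine weylDiffReal_nonpos h0 h1 (summable_delayed hs0 hs1 j)
    (delayed_nonpos hs0 hs1 h.ne') fun m hm => ?_
  rw [delayed, delayed, if_pos h.le, if_pos (by omega)]
  exact cesaroNumber_neg_mono hs0 hs1 (by omega) (by omega)

theorem sum_weylDiffReal_mul {α : ℝ} (h0 : 0 ≤ α) (h1 : α ≤ 1) {f : ℕ → ℝ} (hf : Summable f)
    (b : ℕ → ℝ) (M : ℕ) :
    HasSum (fun m => f m * ∑ n ∈ Finset.range M, delayed α n m * b n)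
      (∑ n ∈ Finset.range M, weylDiffReal α f n * b n) := by
  have := hasSum_sum (s := Finset.range M) fun n _ =>
    ((summable_delayed_mul h0 h1 hf n).hasSum.mul_right (b n))
  have e : (fun m => f m * ∑ n ∈ Finset.range M, delayed α n m * b n) =
      fun m => ∑ n ∈ Finset.range M, delayed α n m * f m * b n := by
    ext m
    rw [Finset.mul_sum]
    exact Finset.sum_congr rfl fun n _ => by ring
  rw [e]
  exact this

/-- The adjoint of W^α sends k^{α+1} to the constant 1; hence, formally, ∑ W^α f(n) k^{α+1}(n) = ∑
f(m). -/
theorem sum_delayed_mul_eq_one (α : ℝ) {m M : ℕ} (h : m < M) :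
    ∑ n ∈ Finset.range M, delayed α n m * cesaroNumber (α + 1) n = 1 := by
  obtain ⟨d, rfl⟩ := Nat.exists_eq_add_of_le (Nat.succ_le_of_lt h)
  rw [Finset.sum_range_add, Finset.sum_eq_zero (s := Finset.range d)
    fun n _ => by rw [delayed_of_lt α (by omega), zero_mul], add_zero]
  refine Eq.trans ?_ (conv_cesaroNumber_neg_add_one α m)
  refine Finset.sum_congr rfl fun n hn => ?_
  have := Finset.mem_range.1 hn
  rw [delayed, if_pos (by omega), mul_comm]

/-- Cutting the pairing at n < M leaves the terms m < M intact. For m ≥ M both f(m) and the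
truncated inner sum are nonpositive, so these terms contribute nonnegatively. -/
theorem sum_le_sum_weylDiffReal_mul {α : ℝ} (h0 : 0 ≤ α) (h1 : α ≤ 1) {f : ℕ → ℝ}
    (hf : Summable f) {M : ℕ} (hM : ∀ m, M ≤ m → f m ≤ 0) :
    ∑ m ∈ Finset.range M, f m ≤
      ∑ n ∈ Finset.range M, weylDiffReal α f n * cesaroNumber (α + 1) n := by
  have h := sum_weylDiffReal_mul h0 h1 hf (cesaroNumber (α + 1)) M
  refine le_of_eq_of_le ?_ (sum_le_hasSum (Finset.range M) (fun m hm => ?_) h)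
  · refine Finset.sum_congr rfl fun m hm => ?_
    rw [sum_delayed_mul_eq_one α (Finset.mem_range.1 hm), mul_one]
  · have hm' : M ≤ m := by simpa using hm
    refine mul_nonneg_of_nonpos_of_nonpos (hM m hm') (Finset.sum_nonpos fun n hn => ?_)
    have := Finset.mem_range.1 hn
    exact mul_nonpos_of_nonpos_of_nonneg (delayed_nonpos h0 h1 (by omega))
      (cesaroNumber_nonneg (by linarith) n)

/-- A sequence which is nonpositive from `N` on together with its Weyl difference, and whose
partial sums are nonnegative from `N` on, has its weighted Weyl difference controlled by the
first `N` terms. -/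
theorem sum_abs_weylDiffReal_mul_le {α : ℝ} (h0 : 0 ≤ α) (h1 : α ≤ 1) {f : ℕ → ℝ}
    (hf : Summable f) {N : ℕ} (hN : ∀ m, N ≤ m → f m ≤ 0)
    (hW : ∀ n, N ≤ n → weylDiffReal α f n ≤ 0)
    (hS : ∀ M, N ≤ M → 0 ≤ ∑ m ∈ Finset.range M, f m) {B : ℝ}
    (hB : ∑ n ∈ Finset.range N, |weylDiffReal α f n| * cesaroNumber (α + 1) n ≤ B) (M : ℕ) :
    ∑ n ∈ Finset.range M, |weylDiffReal α f n| * cesaroNumber (α + 1) n ≤ 2 * B := by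
  have hk : ∀ n, 0 ≤ cesaroNumber (α + 1) n := cesaroNumber_nonneg (by linarith)
  have hmono : ∑ n ∈ Finset.range M, |weylDiffReal α f n| * cesaroNumber (α + 1) n ≤
      ∑ n ∈ Finset.range (N + M), |weylDiffReal α f n| * cesaroNumber (α + 1) n :=
    Finset.sum_le_sum_of_subset_of_nonneg (Finset.range_mono (by omega))
      fun n _ _ => mul_nonneg (abs_nonneg _) (hk n)
  -- The signed weighted sum is nonnegative, so the tail, where every term is nonpositive, has
  -- absolute value at most that of the head: hence the factor 2.
  have hlow := (hS (N + M) (by omega)).trans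
    (sum_le_sum_weylDiffReal_mul h0 h1 hf (M := N + M) fun m hm => hN m (by omega))
  rw [Finset.sum_range_add] at hmono hlow
  have e : ∑ x ∈ Finset.range M, |weylDiffReal α f (N + x)| * cesaroNumber (α + 1) (N + x) =
      -∑ x ∈ Finset.range M, weylDiffReal α f (N + x) * cesaroNumber (α + 1) (N + x) := by
    rw [← Finset.sum_neg_distrib]
    refine Finset.sum_congr rfl fun x _ => ?_
    rw [abs_of_nonpos (hW _ (by omega)), neg_mul]
  have hle : ∑ n ∈ Finset.range N, weylDiffReal α f n * cesaroNumber (α + 1) n ≤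
      ∑ n ∈ Finset.range N, |weylDiffReal α f n| * cesaroNumber (α + 1) n :=
    Finset.sum_le_sum fun n _ => mul_le_mul_of_nonneg_right (le_abs_self _) (hk n)
  linarith

theorem sum_abs_weylDiffReal_mul_le_tsum {α : ℝ} (h0 : 0 ≤ α) (h1 : α ≤ 1) {f : ℕ → ℝ}
    (hf : Summable f) (N : ℕ) :
    ∑ n ∈ Finset.range N, |weylDiffReal α f n| * cesaroNumber (α + 1) n ≤
      ∑' m, |f m| * ∑ n ∈ Finset.range N, |delayed α n m| * cesaroNumber (α + 1) n := by
  have hk : ∀ n, 0 ≤ cesaroNumber (α + 1) n := cesaroNumber_nonneg (by linarith)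
  have hs : ∀ n, Summable fun m => |delayed α n m * f m| := fun n =>
    (summable_delayed_mul h0 h1 hf n).abs
  have h2 := hasSum_sum (s := Finset.range N) fun n _ =>
    ((hs n).hasSum.mul_right (cesaroNumber (α + 1) n))
  refine (Finset.sum_le_sum fun n _ => mul_le_mul_of_nonneg_right ?_ (hk n)).trans
    (h2.tsum_eq.symm.trans ?_).le
  · exact norm_tsum_le_tsum_norm (f := fun m => delayed α n m * f m) (hs n)
  · congr 1
    ext m
    rw [Finset.mul_sum]
    exact Finset.sum_congr rfl fun n _ => by rw [abs_mul]; ring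

/-- The sign argument with head n ≤ j. The constant is 8 = 2 · 2 · 2: one factor from that argument,
and one each from the ℓ¹ bounds on k^{-α} and k^{-s}. -/
theorem sum_abs_weylDiffReal_delayed_mul_le {α s : ℝ} (h0 : 0 ≤ α) (h1 : α ≤ 1) (hs0 : 0 ≤ s)
    (hs1 : s ≤ 1) (j M : ℕ) :
    ∑ n ∈ Finset.range M, |weylDiffReal α (delayed s j) n| * cesaroNumber (α + 1) n ≤
      8 * cesaroNumber (α + 1) j := by
  have hk : ∀ n, 0 ≤ cesaroNumber (α + 1) n := cesaroNumber_nonneg (by linarith)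
  have hf := summable_delayed hs0 hs1 j
  rw [show 8 * cesaroNumber (α + 1) j = 2 * (4 * cesaroNumber (α + 1) j) by ring]
  refine sum_abs_weylDiffReal_mul_le h0 h1 hf (N := j + 1)
    (fun m hm => delayed_nonpos hs0 hs1 (by omega))
    (fun n hn => weylDiffReal_delayed_nonpos h0 h1 hs0 hs1 (by omega))
    (fun M _ => sum_delayed_nonneg hs1 j M) ?_ M
  refine (sum_abs_weylDiffReal_mul_le_tsum h0 h1 hf _).trans ?_
  refine Real.tsum_le_of_sum_range_le (fun m => mul_nonneg (abs_nonneg _)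
    (Finset.sum_nonneg fun n _ => mul_nonneg (abs_nonneg _) (hk n))) fun L => ?_
  calc _ ≤ ∑ m ∈ Finset.range L, |delayed s j m| * (2 * cesaroNumber (α + 1) j) := by
        refine Finset.sum_le_sum fun m _ => mul_le_mul_of_nonneg_left ?_ (abs_nonneg _)
        calc _ ≤ ∑ n ∈ Finset.range (j + 1), |delayed α n m| * cesaroNumber (α + 1) j := by
              refine Finset.sum_le_sum fun n hn => mul_le_mul_of_nonneg_left ?_ (abs_nonneg _)
              exact monotone_cesaroNumber_add_one h0 (Finset.mem_range_succ_iff.1 hn)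
          _ ≤ _ := by
              rw [← Finset.sum_mul]
              exact mul_le_mul_of_nonneg_right (sum_abs_delayed_left_le h0 h1 _ m) (hk j)
    _ ≤ 2 * (2 * cesaroNumber (α + 1) j) := by
        rw [← Finset.sum_mul]
        exact mul_le_mul_of_nonneg_right (sum_abs_delayed_right_le hs0 hs1 j L)
          (mul_nonneg zero_le_two (hk j))
    _ = _ := by ring

/-! ### The coefficients of `∑_{j<N} k^s(j) z^j (1 - z)^s` -/

/-- The Taylor coefficients of `(∑_{j<N} k^s(j) z^j) (1 - z)^s`. -/
def truncCoeff (s : ℝ) (N m : ℕ) : ℝ :=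
  ∑ j ∈ Finset.range N, cesaroNumber s j * delayed s j m

theorem summable_truncCoeff {s : ℝ} (hs0 : 0 ≤ s) (hs1 : s ≤ 1) (N : ℕ) :
    Summable (truncCoeff s N) :=
  summable_sum fun j _ => (summable_delayed hs0 hs1 j).mul_left _

theorem mul_truncCoeff (s : ℝ) {N m : ℕ} (h : N ≤ m) :
    (m : ℝ) * truncCoeff s N m = -(N * cesaroNumber s N * cesaroNumber (1 - s) (m - N)) := by
  rw [← mul_sum_cesaroNumber_mul s h, truncCoeff]
  congr 1
  refine Finset.sum_congr rfl fun j hj => ?_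
  have := Finset.mem_range.1 hj
  rw [delayed, if_pos (by omega)]

/-- Below degree N the truncation is invisible, and (1-z)^{-s} (1-z)^s = 1. -/
theorem truncCoeff_of_lt (s : ℝ) {N m : ℕ} (h : m < N) :
    truncCoeff s N m = if m = 0 then 1 else 0 := by
  obtain ⟨d, rfl⟩ := Nat.exists_eq_add_of_le (Nat.succ_le_of_lt h)
  rw [← sum_cesaroNumber_mul_neg s m, truncCoeff, Finset.sum_range_add,
    Finset.sum_eq_zero (s := Finset.range d)
      fun n _ => by rw [delayed_of_lt s (by omega), mul_zero], add_zero]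
  refine Finset.sum_congr rfl fun j hj => ?_
  have := Finset.mem_range.1 hj
  rw [delayed, if_pos (by omega)]

theorem truncCoeff_nonpos {s : ℝ} (hs0 : 0 ≤ s) (hs1 : s ≤ 1) {N m : ℕ} (h : N ≤ m) :
    truncCoeff s N m ≤ 0 :=
  Finset.sum_nonpos fun j hj => by
    have := Finset.mem_range.1 hj
    exact mul_nonpos_of_nonneg_of_nonpos (cesaroNumber_nonneg hs0 j)
      (delayed_nonpos hs0 hs1 (by omega))

theorem truncCoeff_add (s : ℝ) {N : ℕ} (hN : 0 < N) (x : ℕ) :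
    truncCoeff s N (N + x) = -(N * cesaroNumber s N * (cesaroNumber (1 - s) x / (N + x))) := by
  have h := mul_truncCoeff s (Nat.le_add_right N x)
  have : (N : ℝ) + x ≠ 0 := by positivity
  rw [Nat.add_sub_cancel_left] at h
  push_cast at h
  field_simp
  linarith

theorem sum_truncCoeff_nonneg {s : ℝ} (hs0 : 0 ≤ s) (hs1 : s ≤ 1) (N M : ℕ) :
    0 ≤ ∑ m ∈ Finset.range M, truncCoeff s N m := by
  simp only [truncCoeff]
  rw [Finset.sum_comm]
  refine Finset.sum_nonneg fun j _ => ?_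
  rw [← Finset.mul_sum]
  exact mul_nonneg (cesaroNumber_nonneg hs0 j) (sum_delayed_nonneg hs1 j M)

theorem sum_truncCoeff_of_le (s : ℝ) {N : ℕ} (hN : 0 < N) (g : ℕ → ℝ) :
    ∑ m ∈ Finset.range N, truncCoeff s N m * g m = g 0 := by
  rw [Finset.sum_eq_single_of_mem 0 (Finset.mem_range.2 hN), truncCoeff_of_lt s hN]
  · simp
  · intro m hm h0
    simp [truncCoeff_of_lt s (Finset.mem_range.1 hm), h0]

/-- The partial sums of `truncCoeff p N` are nonnegative: the term 1 at m = 0 dominates the negative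
tail, which is the left-hand side. -/
theorem sum_cesaroNumber_div_le {p : ℝ} (h0 : 0 ≤ p) (h1 : p ≤ 1) {N : ℕ} (hN : 0 < N) (M : ℕ) :
    N * cesaroNumber p N * ∑ x ∈ Finset.range M, cesaroNumber (1 - p) x / (N + x) ≤ 1 := by
  have h := sum_truncCoeff_nonneg h0 h1 N (N + M)
  rw [Finset.sum_range_add] at h
  have e := sum_truncCoeff_of_le p hN fun _ => 1
  simp only [mul_one] at e
  rw [e] at h
  simp only [truncCoeff_add p hN, Finset.sum_neg_distrib] at h
  rw [Finset.mul_sum]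
  linarith

theorem sum_cesaroNumber_neg_reflect (α : ℝ) (N x : ℕ) :
    ∑ n ∈ Finset.range N, cesaroNumber (-α) (N + x - n) =
      cesaroNumber (1 - α) (N + x) - cesaroNumber (1 - α) x := by
  induction N with
  | zero => simp
  | succ N ih =>
    rw [Finset.sum_range_succ']
    have e : ∀ n, N + 1 + x - (n + 1) = N + x - n := fun n => by omega
    simp only [e, ih, Nat.sub_zero]
    rw [show N + 1 + x = N + x + 1 by omega, show 1 - α = -α + 1 by ring,
      cesaroNumber_add_one_succ]
    ring

/-- Bound the increasing weight by its value at N; the remaining sum of -k^{-α} telescopes to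
k^{1-α}(x) - k^{1-α}(N+x). -/
theorem sum_abs_delayed_mul_le {α : ℝ} (h0 : 0 ≤ α) (h1 : α ≤ 1) (N x : ℕ) :
    ∑ n ∈ Finset.range N, |delayed α n (N + x)| * cesaroNumber (α + 1) n ≤
      cesaroNumber (α + 1) N * cesaroNumber (1 - α) x := by
  have hk : ∀ n, 0 ≤ cesaroNumber (α + 1) n := cesaroNumber_nonneg (by linarith)
  calc _ ≤ ∑ n ∈ Finset.range N, -cesaroNumber (-α) (N + x - n) * cesaroNumber (α + 1) N := by
        refine Finset.sum_le_sum fun n hn => ?_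
        have := Finset.mem_range.1 hn
        have e : |delayed α n (N + x)| = -cesaroNumber (-α) (N + x - n) := by
          rw [delayed, if_pos (by omega),
            abs_of_nonpos (cesaroNumber_neg_nonpos h0 h1 (by omega))]
        rw [e]
        refine mul_le_mul_of_nonneg_left (monotone_cesaroNumber_add_one h0 this.le) ?_
        rw [← e]
        exact abs_nonneg _
    _ = (cesaroNumber (1 - α) x - cesaroNumber (1 - α) (N + x)) * cesaroNumber (α + 1) N := by
        rw [← Finset.sum_mul, Finset.sum_neg_distrib, sum_cesaroNumber_neg_reflect]
        ring
    _ ≤ _ := by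
        have := cesaroNumber_nonneg (a := 1 - α) (by linarith) (N + x)
        nlinarith [hk N]

theorem weylDiffReal_truncCoeff {α s : ℝ} (h0 : 0 ≤ α) (h1 : α ≤ 1) (hs0 : 0 ≤ s) (hs1 : s ≤ 1)
    (N n : ℕ) : weylDiffReal α (truncCoeff s N) n =
      ∑ j ∈ Finset.range N, cesaroNumber s j * weylDiffReal α (delayed s j) n := by
  have := hasSum_sum (s := Finset.range N) fun j _ =>
    ((summable_delayed_mul h0 h1 (summable_delayed hs0 hs1 j) n).hasSum.mul_left
      (cesaroNumber s j))
  refine Eq.trans ?_ this.tsum_eq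
  refine tsum_congr fun m => ?_
  rw [truncCoeff, Finset.mul_sum]
  exact Finset.sum_congr rfl fun j _ => by ring

theorem exists_sum_abs_weylDiffReal_truncCoeff_le {α s : ℝ} (h0 : 0 ≤ α) (hs0 : 0 < s)
    (hαs : α < 1 - s) : ∃ C : ℝ, ∀ N M : ℕ,
      ∑ n ∈ Finset.range M, |weylDiffReal α (truncCoeff s N) n| * cesaroNumber (α + 1) n ≤ C := by
  have h1 : α ≤ 1 := by linarith
  have hs1 : s ≤ 1 := by linarith
  have hk : ∀ n, 0 ≤ cesaroNumber (α + 1) n := cesaroNumber_nonneg (by linarith)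
  obtain ⟨C, hC⟩ := exists_cesaroNumber_mul_le (a := 1 - s) (b := 1 - α) (c := 1 - (s + α))
    (by linarith) (by ring)
  obtain ⟨D, hD⟩ := exists_cesaroNumber_mul_le (a := s) (b := α + 1) (c := s + α)
    (by linarith) (by ring)
  have hC0 : 0 ≤ C := by have := hC 0; simp at this; linarith
  have hD0 : 0 ≤ D := by have := hD 0; simp at this; linarith
  -- The head contributes 1 from m = 0, nothing from 0 < m < N and at most C * D from m ≥ N; the 2
  -- is from the sign argument.
  refine ⟨2 * (1 + C * D), fun N M => ?_⟩
  rcases Nat.eq_zero_or_pos N with rfl | hN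
  · have : ∀ n, weylDiffReal α (truncCoeff s 0) n = 0 := fun n => by
      rw [weylDiffReal_truncCoeff h0 h1 hs0.le hs1]; simp
    simp only [this, abs_zero, zero_mul, Finset.sum_const_zero]
    positivity
  have hf := summable_truncCoeff hs0.le hs1 N
  refine sum_abs_weylDiffReal_mul_le h0 h1 hf (N := N)
    (fun m hm => truncCoeff_nonpos hs0.le hs1 hm) (fun n hn => ?_)
    (fun M _ => sum_truncCoeff_nonneg hs0.le hs1 N M) ?_ M
  · rw [weylDiffReal_truncCoeff h0 h1 hs0.le hs1]
    refine Finset.sum_nonpos fun j hj => ?_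
    have := Finset.mem_range.1 hj
    exact mul_nonpos_of_nonneg_of_nonpos (cesaroNumber_nonneg hs0.le j)
      (weylDiffReal_delayed_nonpos h0 h1 hs0.le hs1 (by omega))
  refine (sum_abs_weylDiffReal_mul_le_tsum h0 h1 hf _).trans ?_
  have hnn : ∀ m, 0 ≤ |truncCoeff s N m| *
      ∑ n ∈ Finset.range N, |delayed α n m| * cesaroNumber (α + 1) n := fun m =>
    mul_nonneg (abs_nonneg _) (Finset.sum_nonneg fun n _ => mul_nonneg (abs_nonneg _) (hk n))
  refine Real.tsum_le_of_sum_range_le hnn fun L => ?_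
  refine (Finset.sum_le_sum_of_subset_of_nonneg (Finset.range_mono (Nat.le_add_left L N))
    fun m _ _ => hnn m).trans ?_
  rw [Finset.sum_range_add]
  have hfirst : ∑ m ∈ Finset.range N, |truncCoeff s N m| *
      ∑ n ∈ Finset.range N, |delayed α n m| * cesaroNumber (α + 1) n = 1 := by
    rw [Finset.sum_eq_single_of_mem 0 (Finset.mem_range.2 hN)]
    · rw [truncCoeff_of_lt s hN, Finset.sum_eq_single_of_mem 0 (Finset.mem_range.2 hN)]
      · simp
      · intro n _ hn
        rw [delayed_of_lt α (Nat.pos_of_ne_zero hn), abs_zero, zero_mul]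
    · intro m hm hm0
      rw [truncCoeff_of_lt s (Finset.mem_range.1 hm), if_neg hm0, abs_zero, zero_mul]
  have hsecond : ∑ x ∈ Finset.range L, |truncCoeff s N (N + x)| *
      ∑ n ∈ Finset.range N, |delayed α n (N + x)| * cesaroNumber (α + 1) n ≤ C * D := by
    have hp := cesaroNumber_pos (a := s + α) (by linarith) N
    have hN' : (0 : ℝ) < N := by exact_mod_cast hN
    have hsum : 0 ≤ ∑ x ∈ Finset.range L, cesaroNumber (1 - (s + α)) x / (N + x) :=
      Finset.sum_nonneg fun x _ =>
        div_nonneg (cesaroNumber_nonneg (by linarith) x) (by positivity)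
    -- `C` merges the two factors in x into k^{1-(s+α)}(x), and `D` the two in N into k^{s+α}(N);
    -- this is the expression of `sum_cesaroNumber_div_le` with p = s + α.
    calc _ ≤ ∑ x ∈ Finset.range L, N * (cesaroNumber s N * cesaroNumber (α + 1) N) *
          (C * (cesaroNumber (1 - (s + α)) x / (N + x))) := by
          refine Finset.sum_le_sum fun x _ => ?_
          have hx : (0 : ℝ) < N + x := by positivity
          rw [abs_of_nonpos (truncCoeff_nonpos hs0.le hs1 (Nat.le_add_right N x)),
            truncCoeff_add s hN, neg_neg]
          have hks := cesaroNumber_nonneg hs0.le N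
          have hk1 := cesaroNumber_nonneg (a := 1 - s) (by linarith) x
          calc _ ≤ N * cesaroNumber s N * (cesaroNumber (1 - s) x / (N + x)) *
                (cesaroNumber (α + 1) N * cesaroNumber (1 - α) x) :=
                mul_le_mul_of_nonneg_left (sum_abs_delayed_mul_le h0 h1 N x) (by positivity)
            _ = N * (cesaroNumber s N * cesaroNumber (α + 1) N) *
                (cesaroNumber (1 - s) x * cesaroNumber (1 - α) x / (N + x)) := by ring
            _ ≤ _ := by
                refine mul_le_mul_of_nonneg_left ?_ (mul_nonneg hN'.le (mul_nonneg hks (hk N)))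
                rw [← mul_div_assoc]
                exact div_le_div_of_nonneg_right (hC x) hx.le
      _ = C * (N * (cesaroNumber s N * cesaroNumber (α + 1) N)) *
          ∑ x ∈ Finset.range L, cesaroNumber (1 - (s + α)) x / (N + x) := by
          rw [Finset.mul_sum]
          exact Finset.sum_congr rfl fun x _ => by ring
      _ ≤ C * (N * (D * cesaroNumber (s + α) N)) *
          ∑ x ∈ Finset.range L, cesaroNumber (1 - (s + α)) x / (N + x) := by
          refine mul_le_mul_of_nonneg_right ?_ hsum
          exact mul_le_mul_of_nonneg_left (mul_le_mul_of_nonneg_left (hD N) hN'.le) hC0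
      _ = C * D * (N * cesaroNumber (s + α) N *
          ∑ x ∈ Finset.range L, cesaroNumber (1 - (s + α)) x / (N + x)) := by ring
      _ ≤ C * D * 1 := by
          refine mul_le_mul_of_nonneg_left ?_ (mul_nonneg hC0 hD0)
          exact sum_cesaroNumber_div_le (by linarith) (by linarith) hN L
      _ = _ := mul_one _
  linarith

/-! ### Summation by parts and product identities -/

theorem summable_prod_mul_of_sum_range_le {u c : ℕ → ℝ} {v : ℕ → ℕ → ℝ} (hu : ∀ j, 0 ≤ u j)
    (hv : ∀ j m, 0 ≤ v j m) (hc : ∀ j M, ∑ m ∈ Finset.range M, v j m ≤ c j)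
    (huc : Summable fun j => u j * c j) : Summable fun p : ℕ × ℕ => u p.1 * v p.1 p.2 := by
  have hs : ∀ j, Summable (v j) := fun j => summable_of_sum_range_le (hv j) (hc j)
  have hnn : (0 : ℕ × ℕ → ℝ) ≤ fun p => u p.1 * v p.1 p.2 :=
    fun p => mul_nonneg (hu p.1) (hv p.1 p.2)
  have h1 : ∀ j, Summable fun m => u j * v j m := fun j => (hs j).mul_left _
  have h2 : Summable fun j => ∑' m, u j * v j m := by
    refine Summable.of_nonneg_of_le (fun j => tsum_nonneg fun m => mul_nonneg (hu j) (hv j m))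
      (fun j => ?_) huc
    rw [tsum_mul_left]
    exact mul_le_mul_of_nonneg_left (Real.tsum_le_of_sum_range_le (hv j) (hc j)) (hu j)
  exact (summable_prod_of_nonneg hnn).2 ⟨h1, h2⟩

theorem tsum_weylDiffReal_mul {α : ℝ} (h0 : 0 ≤ α) (h1 : α ≤ 1) {f b : ℕ → ℝ} (hf : Summable f)
    (hb : ∀ n, |b n| ≤ 1) :
    ∑' n, weylDiffReal α f n * b n =
      ∑' m, f m * ∑ n ∈ Finset.range (m + 1), cesaroNumber (-α) (m - n) * b n := by
  have hsum : Summable fun p : ℕ × ℕ => delayed α p.2 p.1 * f p.1 * b p.2 := by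
    refine Summable.of_norm_bounded (summable_prod_mul_of_sum_range_le (fun m => abs_nonneg (f m))
      (v := fun m n => |delayed α n m|) (fun m n => abs_nonneg _)
      (fun m N => sum_abs_delayed_left_le h0 h1 N m) (hf.abs.mul_right 2)) fun p => ?_
    rw [Real.norm_eq_abs, abs_mul, abs_mul, mul_comm |delayed α p.2 p.1|]
    exact mul_le_of_le_one_right (mul_nonneg (abs_nonneg _) (abs_nonneg _)) (hb _)
  calc ∑' n, weylDiffReal α f n * b n = ∑' n, ∑' m, delayed α n m * f m * b n :=
        tsum_congr fun n => by rw [weylDiffReal, tsum_mul_right]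
    _ = ∑' m, ∑' n, delayed α n m * f m * b n :=
        Summable.tsum_comm (f := fun m n => delayed α n m * f m * b n) hsum
    _ = _ := tsum_congr fun m => by
        rw [tsum_eq_sum (s := Finset.range (m + 1)), Finset.mul_sum]
        · refine Finset.sum_congr rfl fun n hn => ?_
          have := Finset.mem_range.1 hn
          rw [delayed, if_pos (by omega)]
          ring
        · intro n hn
          rw [delayed_of_lt α (by simpa using hn), zero_mul, zero_mul]

theorem sum_cesaroNumber_neg_mul_succ (α : ℝ) (m : ℕ) :
    ∑ n ∈ Finset.range (m + 1), cesaroNumber (-α) (m - n) * cesaroNumber α (n + 1) =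
      -cesaroNumber (-α) (m + 1) := by
  have h := sum_cesaroNumber_mul_neg α (m + 1)
  rw [Finset.sum_range_succ', if_neg (by omega)] at h
  simp only [Nat.add_sub_add_right, cesaroNumber_zero, one_mul, Nat.sub_zero] at h
  rw [← eq_neg_iff_add_eq_zero] at h
  rw [← h]
  exact Finset.sum_congr rfl fun n _ => mul_comm _ _

theorem weylDiffReal_delayed_succ_succ {α s : ℝ} (h0 : 0 ≤ α) (h1 : α ≤ 1) (hs0 : 0 ≤ s)
    (hs1 : s ≤ 1) (j n : ℕ) :
    weylDiffReal α (delayed s (j + 1)) (n + 1) = weylDiffReal α (delayed s j) n := by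
  rw [weylDiffReal,
    (summable_delayed_mul h0 h1 (summable_delayed hs0 hs1 (j + 1)) (n + 1)).tsum_eq_zero_add]
  simp [delayed_succ_succ, delayed_of_lt, weylDiffReal]

/-- Fubini together with k^{-α} * k^α = δ. It accounts for the multiples of I produced when T acts
on Cesàro sums in `mul_calculusReal_delayed`. -/
theorem weylDiffReal_delayed_succ_zero {α s : ℝ} (h0 : 0 ≤ α) (h1 : α ≤ 1) (hs0 : 0 ≤ s)
    (hs1 : s ≤ 1) (j : ℕ) :
    weylDiffReal α (delayed s (j + 1)) 0 =
      -∑' n, weylDiffReal α (delayed s j) n * cesaroNumber α (n + 1) := by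
  rw [tsum_weylDiffReal_mul h0 h1 (summable_delayed hs0 hs1 j)
    (b := fun n => cesaroNumber α (n + 1)), weylDiffReal,
    (summable_delayed_mul h0 h1 (summable_delayed hs0 hs1 (j + 1)) 0).tsum_eq_zero_add, ← tsum_neg]
  · rw [delayed_of_lt s (Nat.succ_pos j), mul_zero, zero_add]
    refine tsum_congr fun m => ?_
    rw [sum_cesaroNumber_neg_mul_succ, delayed_succ_succ]
    simp only [delayed, Nat.zero_le, if_true, Nat.sub_zero]
    ring
  · intro n
    rw [abs_of_nonneg (cesaroNumber_nonneg h0 _)]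
    exact cesaroNumber_le_one h0 h1 _

/-- After exchanging sums, this is W^α applied to the coefficients 1, -1, 0, … of (1-z)^{1-s}
(1-z)^s = 1 - z. -/
theorem tsum_cesaroNumber_mul_weylDiffReal_delayed {α s : ℝ} (h0 : 0 ≤ α) (h1 : α ≤ 1)
    (hs0 : 0 ≤ s) (hs1 : s ≤ 1) (n : ℕ) :
    ∑' j, cesaroNumber (s - 1) j * weylDiffReal α (delayed s j) n =
      delayed α n 0 - delayed α n 1 := by
  have hk : Summable fun j => |cesaroNumber (s - 1) j| := by
    have := summable_abs_cesaroNumber_neg (a := 1 - s) (by linarith) (by linarith)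
    rwa [neg_sub] at this
  have hsum : Summable fun p : ℕ × ℕ =>
      cesaroNumber (s - 1) p.1 * (delayed α n p.2 * delayed s p.1 p.2) := by
    refine Summable.of_norm_bounded (summable_prod_mul_of_sum_range_le
      (fun j => abs_nonneg (cesaroNumber (s - 1) j))
      (v := fun j m => |delayed s j m|) (fun j m => abs_nonneg _)
      (fun j M => sum_abs_delayed_right_le hs0 hs1 j M) (hk.mul_right 2)) fun p => ?_
    rw [Real.norm_eq_abs, abs_mul, abs_mul]
    refine mul_le_mul_of_nonneg_left ?_ (abs_nonneg _)
    exact mul_le_of_le_one_left (abs_nonneg _) (abs_delayed_le_one h0 h1 n p.2)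
  calc _ = ∑' j, ∑' m, cesaroNumber (s - 1) j * (delayed α n m * delayed s j m) :=
        tsum_congr fun j => by rw [weylDiffReal, tsum_mul_left]
    _ = ∑' m, ∑' j, cesaroNumber (s - 1) j * (delayed α n m * delayed s j m) :=
        (Summable.tsum_comm
          (f := fun j m => cesaroNumber (s - 1) j * (delayed α n m * delayed s j m)) hsum).symm
    _ = ∑' m, delayed α n m * (if m = 0 then 1 else if m = 1 then -1 else 0) :=
        tsum_congr fun m => by
          rw [tsum_eq_sum (s := Finset.range (m + 1)), ← conv_cesaroNumber_sub_one_neg s m, conv,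
            Finset.mul_sum]
          · refine Finset.sum_congr rfl fun j hj => ?_
            have := Finset.mem_range.1 hj
            rw [show delayed s j m = cesaroNumber (-s) (m - j) by
              rw [delayed, if_pos (by omega)]]
            ring
          · intro j hj
            rw [delayed_of_lt s (by simpa using hj), mul_zero, mul_zero]
    _ = _ := by
        rw [tsum_eq_sum (s := Finset.range 2)]
        · simp [Finset.sum_range_succ]; ring
        · intro m hm
          have : 1 < m := by simpa using hm
          rw [if_neg (by omega), if_neg (by omega), mul_zero]

/-- Here m = 1, and the two series of W W^{-(1-α)} f merge because k^{1-α}(i+1) - k^{1-α}(i) =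
k^{-α}(i+1). -/
theorem weylDiff_ofReal {α : ℝ} (h0 : 0 ≤ α) (h1 : α < 1) {f : ℕ → ℝ} (hf : Summable f) (n : ℕ) :
    weylDiff α (fun m => (f m : ℂ)) n = (weylDiffReal α f n : ℂ) := by
  have hs : ∀ n, Summable fun i => cesaroNumber (1 - α) i * f (n + i) := fun n => by
    have hfn : Summable fun i => f (n + i) := by
      simpa [add_comm] using (summable_nat_add_iff n).2 hf
    refine Summable.of_norm_bounded hfn.abs fun i => ?_
    rw [Real.norm_eq_abs, abs_mul, abs_of_nonneg (cesaroNumber_nonneg (by linarith) i)]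
    exact mul_le_of_le_one_left (abs_nonneg _) (cesaroNumber_one_sub_le_one h0 h1.le i)
  have hr : ∑' i, cesaroNumber (1 - α) i * f (n + i) -
      ∑' i, cesaroNumber (1 - α) i * f (n + 1 + i) = weylDiffReal α f n := by
    have e : ∀ i, n + (i + 1) = n + 1 + i := fun i => by omega
    have hs' : Summable fun i => cesaroNumber (1 - α) (i + 1) * f (n + 1 + i) :=
      ((summable_nat_add_iff 1).2 (hs n)).congr fun i => by rw [← e]
    rw [weylDiffReal_eq_tsum, (hs n).tsum_eq_zero_add]
    have hneg : Summable fun i => cesaroNumber (-α) i * f (n + i) := by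
      have hfn : Summable fun i => f (n + i) := by
        simpa [add_comm] using (summable_nat_add_iff n).2 hf
      refine Summable.of_norm_bounded hfn.abs fun i => ?_
      rw [Real.norm_eq_abs, abs_mul]
      exact mul_le_of_le_one_left (abs_nonneg _) (abs_cesaroNumber_neg_le_one h0 h1.le i)
    rw [hneg.tsum_eq_zero_add]
    simp only [fun i => congrArg f (e i), cesaroNumber_zero]
    rw [add_sub_assoc, ← hs'.tsum_sub (hs (n + 1))]
    congr 1
    refine tsum_congr fun i => ?_
    rw [show 1 - α = -α + 1 by ring, cesaroNumber_add_one_succ]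
    ring
  have hfl : ⌊α⌋₊ = 0 := Nat.floor_eq_zero.2 h1
  rw [weylDiff, hfl, ← hr]
  simp only [zero_add, Function.iterate_one, diff, weylSum, Nat.cast_one, Complex.ofReal_sub,
    Complex.ofReal_tsum, Complex.ofReal_mul]

/-! ### Cesàro sums of an operator, its calculus and binomial sums. -/

variable {X : Type*} [NormedAddCommGroup X] [NormedSpace ℂ X]

theorem cesaroSum_zero (α : ℝ) (T : X →L[ℂ] X) : cesaroSum α T 0 = 1 := by
  simp [cesaroSum]

theorem mul_cesaroSum (α : ℝ) (T : X →L[ℂ] X) (n : ℕ) :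
    T * cesaroSum α T n = cesaroSum α T (n + 1) - (cesaroNumber α (n + 1) : ℂ) • 1 := by
  rw [cesaroSum, cesaroSum, Finset.sum_range_succ' _ (n + 1), Finset.mul_sum]
  simp [pow_succ']

theorem pow_eq_sum_cesaroSum (α : ℝ) (T : X →L[ℂ] X) (n : ℕ) :
    T ^ n = ∑ j ∈ Finset.range (n + 1), (cesaroNumber (-α) (n - j) : ℂ) • cesaroSum α T j := by
  induction n with
  | zero => simp [cesaroSum_zero]
  | succ n ih =>
    rw [pow_succ', ih, Finset.mul_sum, Finset.sum_range_succ' _ (n + 1)]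
    simp only [mul_smul_comm, mul_cesaroSum, smul_sub, Finset.sum_sub_distrib, smul_smul,
      Nat.add_sub_add_right, Nat.sub_zero, cesaroSum_zero, ← Finset.sum_smul]
    have h := congrArg (fun r : ℝ => (r : ℂ)) (sum_cesaroNumber_neg_mul_succ α n)
    push_cast at h
    rw [h, neg_smul, sub_neg_eq_add]

theorem IsCesaroBounded.exists_norm_cesaroSum_le {α : ℝ} (h0 : 0 ≤ α) {T : X →L[ℂ] X}
    (hT : IsCesaroBounded α T) :
    ∃ K : ℝ, 0 ≤ K ∧ ∀ n, ‖cesaroSum α T n‖ ≤ K * cesaroNumber (α + 1) n := by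
  obtain ⟨K, hK⟩ := hT
  refine ⟨K, (norm_nonneg _).trans (hK 0), fun n => ?_⟩
  have hpos := cesaroNumber_pos (a := α + 1) (by linarith) n
  have h := hK n
  rw [cesaroMean, norm_smul, norm_inv, Complex.norm_real, Real.norm_of_nonneg hpos.le,
    inv_mul_le_iff₀ hpos] at h
  linarith

theorem norm_pow_le {α K : ℝ} (h0 : 0 ≤ α) (h1 : α ≤ 1) {T : X →L[ℂ] X} (hK0 : 0 ≤ K)
    (hK : ∀ n, ‖cesaroSum α T n‖ ≤ K * cesaroNumber (α + 1) n) (n : ℕ) :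
    ‖T ^ n‖ ≤ 2 * K * cesaroNumber (α + 1) n := by
  have hk : ∀ n, 0 ≤ cesaroNumber (α + 1) n := cesaroNumber_nonneg (by linarith)
  rw [pow_eq_sum_cesaroSum α T n]
  calc _ ≤ ∑ j ∈ Finset.range (n + 1),
        -- The unreduced index `n + 1 - 1 - j` is the shape that `Finset.sum_range_reflect` expects.
        |cesaroNumber (-α) (n + 1 - 1 - j)| * (K * cesaroNumber (α + 1) n) := by
        refine norm_sum_le_of_le _ fun j hj => ?_
        rw [norm_smul, Complex.norm_real, Real.norm_eq_abs, Nat.add_sub_cancel]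
        refine mul_le_mul_of_nonneg_left ((hK j).trans (mul_le_mul_of_nonneg_left ?_ hK0))
          (abs_nonneg _)
        exact monotone_cesaroNumber_add_one h0 (Finset.mem_range_succ_iff.1 hj)
    _ = (∑ j ∈ Finset.range (n + 1), |cesaroNumber (-α) j|) * (K * cesaroNumber (α + 1) n) := by
        rw [← Finset.sum_mul, Finset.sum_range_reflect (fun j => |cesaroNumber (-α) j|)]
    _ ≤ 2 * (K * cesaroNumber (α + 1) n) :=
        mul_le_mul_of_nonneg_right (sum_abs_cesaroNumber_neg_le h0 h1 _) (mul_nonneg hK0 (hk n))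
    _ = _ := by ring

/-- The functional calculus of `T` at a real sequence. -/
def calculusReal (α : ℝ) (T : X →L[ℂ] X) (f : ℕ → ℝ) : X →L[ℂ] X :=
  ∑' n, (weylDiffReal α f n : ℂ) • cesaroSum α T n

theorem fracPow_eq {α s : ℝ} (h0 : 0 ≤ α) (h1 : α < 1) (hs0 : 0 ≤ s) (hs1 : s ≤ 1)
    (T : X →L[ℂ] X) : fracPow α T s = calculusReal α T (delayed s 0) := by
  have e : delayed s 0 = cesaroNumber (-s) := by ext m; simp [delayed]
  rw [fracPow, calculus, calculusReal, e]
  exact tsum_congr fun n => by rw [weylDiff_ofReal h0 h1 (summable_cesaroNumber_neg hs0 hs1)]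

theorem norm_weylDiffReal_smul_le {α K : ℝ} {T : X →L[ℂ] X}
    (hK : ∀ n, ‖cesaroSum α T n‖ ≤ K * cesaroNumber (α + 1) n) (f : ℕ → ℝ) (n : ℕ) :
    ‖(weylDiffReal α f n : ℂ) • cesaroSum α T n‖ ≤
      K * (|weylDiffReal α f n| * cesaroNumber (α + 1) n) := by
  rw [norm_smul, Complex.norm_real, Real.norm_eq_abs]
  refine (mul_le_mul_of_nonneg_left (hK n) (abs_nonneg _)).trans (le_of_eq (by ring))

section Bounds

variable {α K C : ℝ} {T : X →L[ℂ] X} {f : ℕ → ℝ}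

theorem sum_norm_weylDiffReal_smul_le (hK0 : 0 ≤ K)
    (hK : ∀ n, ‖cesaroSum α T n‖ ≤ K * cesaroNumber (α + 1) n)
    (hf : ∀ M, ∑ n ∈ Finset.range M, |weylDiffReal α f n| * cesaroNumber (α + 1) n ≤ C) (M : ℕ) :
    ∑ n ∈ Finset.range M, ‖(weylDiffReal α f n : ℂ) • cesaroSum α T n‖ ≤ K * C := by
  refine (Finset.sum_le_sum fun n _ => norm_weylDiffReal_smul_le hK f n).trans ?_
  rw [← Finset.mul_sum]
  exact mul_le_mul_of_nonneg_left (hf M) hK0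

theorem summable_norm_weylDiffReal_smul (hK0 : 0 ≤ K)
    (hK : ∀ n, ‖cesaroSum α T n‖ ≤ K * cesaroNumber (α + 1) n)
    (hf : ∀ M, ∑ n ∈ Finset.range M, |weylDiffReal α f n| * cesaroNumber (α + 1) n ≤ C) :
    Summable fun n => ‖(weylDiffReal α f n : ℂ) • cesaroSum α T n‖ :=
  summable_of_sum_range_le (fun _ => norm_nonneg _) (sum_norm_weylDiffReal_smul_le hK0 hK hf)

theorem norm_calculusReal_le (hK0 : 0 ≤ K)
    (hK : ∀ n, ‖cesaroSum α T n‖ ≤ K * cesaroNumber (α + 1) n)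
    (hf : ∀ M, ∑ n ∈ Finset.range M, |weylDiffReal α f n| * cesaroNumber (α + 1) n ≤ C) :
    ‖calculusReal α T f‖ ≤ K * C :=
  (norm_tsum_le_tsum_norm (summable_norm_weylDiffReal_smul hK0 hK hf)).trans
    (Real.tsum_le_of_sum_range_le (fun _ => norm_nonneg _)
      (sum_norm_weylDiffReal_smul_le hK0 hK hf))

end Bounds

/-- The partial sums of the binomial series of `(I - T)^{-s}`. -/
def binomialSum (s : ℝ) (T : X →L[ℂ] X) (N : ℕ) : X →L[ℂ] X :=
  ∑ n ∈ Finset.range N, (cesaroNumber s n : ℂ) • T ^ n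

/-- Summation by parts, with k^s(n+1) - k^s(n) = k^{s-1}(n+1). -/
theorem binomialSum_succ_mul_one_sub (s : ℝ) (T : X →L[ℂ] X) (N : ℕ) :
    binomialSum s T (N + 1) * (1 - T) =
      ∑ n ∈ Finset.range (N + 1), (cesaroNumber (s - 1) n : ℂ) • T ^ n -
        (cesaroNumber s N : ℂ) • T ^ (N + 1) := by
  induction N with
  | zero => simp [binomialSum]
  | succ N ih =>
    rw [binomialSum] at ih
    rw [binomialSum, Finset.sum_range_succ, add_mul, ih, Finset.sum_range_succ _ (N + 1)]
    have h := cesaroNumber_add_one_succ (s - 1) N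
    rw [sub_add_cancel] at h
    rw [h, smul_mul_assoc, mul_sub, mul_one, ← pow_succ]
    push_cast
    module

theorem sum_Icc_smul_pow_apply (s : ℝ) (T : X →L[ℂ] X) (x : X) (N : ℕ) :
    ∑ n ∈ Finset.Icc 1 N, ((1 / (n : ℝ) ^ (1 - s) : ℝ) : ℂ) • (T ^ n) x =
      (Real.Gamma s : ℂ) • (binomialSum s T (N + 1) x - x) +
        ∑ n ∈ Finset.range N, (((1 / ((n + 1 : ℕ) : ℝ) ^ (1 - s) -
          Real.Gamma s * cesaroNumber s (n + 1) : ℝ)) : ℂ) • (T ^ (n + 1)) x := by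
  induction N with
  | zero => simp [binomialSum]
  | succ N ih =>
    rw [Finset.sum_Icc_succ_top (by omega), ih, Finset.sum_range_succ _ N,
      show binomialSum s T (N + 1 + 1) = binomialSum s T (N + 1) +
        (cesaroNumber s (N + 1) : ℂ) • T ^ (N + 1) from Finset.sum_range_succ _ _]
    rw [_root_.add_apply, _root_.smul_apply, Complex.ofReal_sub,
      Complex.ofReal_mul]
    module

theorem commute_cesaroSum (α : ℝ) (T : X →L[ℂ] X) (n : ℕ) : Commute T (cesaroSum α T n) :=
  Commute.sum_right _ _ _ fun j _ => ((Commute.refl T).pow_right j).smul_right _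

theorem tendsto_apply_of_dense {L : ℕ → X →L[ℂ] X} {C : ℝ} (hC : ∀ N, ‖L N‖ ≤ C) {D : Set X}
    (hD : Dense D) (hL : ∀ z ∈ D, Tendsto (fun N => L N z) atTop (𝓝 z)) (x : X) :
    Tendsto (fun N => L N x) atTop (𝓝 x) := by
  have hC0 : 0 ≤ C := (norm_nonneg _).trans (hC 0)
  rw [Metric.tendsto_atTop]
  intro ε hε
  -- The distance to z enters once directly and once multiplied by `C`, hence `C + 1`.
  obtain ⟨z, hz, hxz⟩ := hD.exists_dist_lt x (ε := ε / (2 * (C + 1))) (by positivity)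
  obtain ⟨N, hN⟩ := Metric.tendsto_atTop.1 (hL z hz) (ε / 2) (by positivity)
  refine ⟨N, fun n hn => ?_⟩
  have h1 := hN n hn
  rw [lt_div_iff₀ (by positivity)] at hxz
  have h2 : dist (L n x) (L n z) ≤ C * dist x z := by
    rw [dist_eq_norm, dist_eq_norm, ← map_sub]
    exact (L n).le_of_opNorm_le (hC n) _
  have h3 := dist_triangle4 (L n x) (L n z) z x
  rw [dist_comm z x] at h3
  nlinarith

theorem cesaroNumber_add_one_succ_le {α : ℝ} (h0 : 0 ≤ α) (h1 : α ≤ 1) (n : ℕ) :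
    cesaroNumber (α + 1) (n + 1) ≤ 2 * cesaroNumber (α + 1) n := by
  have hk : 1 ≤ cesaroNumber (α + 1) n := by
    simpa using monotone_cesaroNumber_add_one h0 (Nat.zero_le n)
  rw [cesaroNumber_add_one_succ]
  linarith [cesaroNumber_le_one h0 h1 (n + 1)]

theorem commute_fracPow {α s : ℝ} (h0 : 0 ≤ α) (h1 : α < 1) (hs0 : 0 ≤ s) (hs1 : s ≤ 1)
    (T : X →L[ℂ] X) : Commute T (fracPow α T s) := by
  rw [fracPow_eq h0 h1 hs0 hs1]
  exact Commute.tsum_right _ fun n => (commute_cesaroSum α T n).smul_right _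

theorem commute_binomialSum_fracPow {α s : ℝ} (h0 : 0 ≤ α) (h1 : α < 1) (hs0 : 0 ≤ s) (hs1 : s ≤ 1)
    (T : X →L[ℂ] X) (N : ℕ) : Commute (binomialSum s T N) (fracPow α T s) :=
  Commute.sum_left _ _ _ fun j _ => ((commute_fracPow h0 h1 hs0 hs1 T).pow_left j).smul_left _

/-! ### Operator estimates and strong convergence. -/

variable [CompleteSpace X] {α s K : ℝ} {T : X →L[ℂ] X}

/-- The only multiplicativity of the calculus that is needed: multiplication by z. T raises the
index of each Cesàro sum and subtracts k^α(n+1) I; these corrections add up to the new term at n =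
0. -/
theorem mul_calculusReal_delayed (h0 : 0 ≤ α) (h1 : α ≤ 1) (hs0 : 0 ≤ s) (hs1 : s ≤ 1)
    (hK0 : 0 ≤ K) (hK : ∀ n, ‖cesaroSum α T n‖ ≤ K * cesaroNumber (α + 1) n) (j : ℕ) :
    T * calculusReal α T (delayed s j) = calculusReal α T (delayed s (j + 1)) := by
  have hS : ∀ j, Summable fun n => (weylDiffReal α (delayed s j) n : ℂ) • cesaroSum α T n :=
    fun j => (summable_norm_weylDiffReal_smul hK0 hK
      (sum_abs_weylDiffReal_delayed_mul_le h0 h1 hs0 hs1 j)).of_norm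
  have hw : Summable fun n => weylDiffReal α (delayed s j) n * cesaroNumber α (n + 1) := by
    refine Summable.of_norm_bounded (g := fun n =>
      |weylDiffReal α (delayed s j) n| * cesaroNumber (α + 1) n)
      (summable_of_sum_range_le (fun n => mul_nonneg (abs_nonneg _)
        (cesaroNumber_nonneg (by linarith) n))
        (sum_abs_weylDiffReal_delayed_mul_le h0 h1 hs0 hs1 j)) fun n => ?_
    rw [Real.norm_eq_abs, abs_mul, abs_of_nonneg (cesaroNumber_nonneg h0 (n + 1))]
    refine mul_le_mul_of_nonneg_left ((cesaroNumber_le_one h0 h1 _).trans ?_) (abs_nonneg _)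
    simpa using monotone_cesaroNumber_add_one h0 (Nat.zero_le n)
  have hw' : Summable fun n => ((weylDiffReal α (delayed s j) n * cesaroNumber α (n + 1) : ℝ) : ℂ) •
      (1 : X →L[ℂ] X) := (Complex.ofRealCLM.summable hw).smul_const _
  have hS1 := (summable_nat_add_iff 1).2 (hS (j + 1))
  simp only [weylDiffReal_delayed_succ_succ h0 h1 hs0 hs1] at hS1
  rw [calculusReal, calculusReal, (hS (j + 1)).tsum_eq_zero_add, ← (hS j).tsum_mul_left,
    cesaroSum_zero, weylDiffReal_delayed_succ_zero h0 h1 hs0 hs1]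
  simp only [weylDiffReal_delayed_succ_succ h0 h1 hs0 hs1]
  have e : ∀ n, T * ((weylDiffReal α (delayed s j) n : ℂ) • cesaroSum α T n) =
      (weylDiffReal α (delayed s j) n : ℂ) • cesaroSum α T (n + 1) -
        ((weylDiffReal α (delayed s j) n * cesaroNumber α (n + 1) : ℝ) : ℂ) •
          (1 : X →L[ℂ] X) := fun n => by
    rw [mul_smul_comm, mul_cesaroSum, smul_sub, smul_smul, Complex.ofReal_mul]
  simp only [e]
  have e2 : ∑' n, ((weylDiffReal α (delayed s j) n * cesaroNumber α (n + 1) : ℝ) : ℂ) •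
      (1 : X →L[ℂ] X) =
      ((∑' n, weylDiffReal α (delayed s j) n * cesaroNumber α (n + 1) : ℝ) : ℂ) • 1 := by
    rw [Complex.ofReal_tsum]
    exact (Complex.ofRealCLM.summable hw).tsum_smul_const _
  rw [hS1.tsum_sub hw', e2, Complex.ofReal_neg, neg_smul]
  abel

theorem pow_mul_fracPow (h0 : 0 ≤ α) (h1 : α < 1) (hs0 : 0 ≤ s) (hs1 : s ≤ 1)
    (hK0 : 0 ≤ K) (hK : ∀ n, ‖cesaroSum α T n‖ ≤ K * cesaroNumber (α + 1) n) (j : ℕ) :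
    T ^ j * fracPow α T s = calculusReal α T (delayed s j) := by
  induction j with
  | zero => rw [pow_zero, one_mul, fracPow_eq h0 h1 hs0 hs1]
  | succ j ih =>
    rw [pow_succ', mul_assoc, ih, mul_calculusReal_delayed h0 h1.le hs0 hs1 hK0 hK]

theorem norm_pow_mul_fracPow_le (h0 : 0 ≤ α) (h1 : α < 1) (hs0 : 0 ≤ s) (hs1 : s ≤ 1)
    (hK0 : 0 ≤ K) (hK : ∀ n, ‖cesaroSum α T n‖ ≤ K * cesaroNumber (α + 1) n) (j : ℕ) :
    ‖T ^ j * fracPow α T s‖ ≤ 8 * K * cesaroNumber (α + 1) j := by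
  rw [pow_mul_fracPow h0 h1 hs0 hs1 hK0 hK]
  refine (norm_calculusReal_le hK0 hK
    (sum_abs_weylDiffReal_delayed_mul_le h0 h1.le hs0 hs1 j)).trans (le_of_eq (by ring))

theorem binomialSum_mul_fracPow (h0 : 0 ≤ α) (h1 : α < 1) (hs0 : 0 ≤ s) (hs1 : s ≤ 1)
    (hK0 : 0 ≤ K) (hK : ∀ n, ‖cesaroSum α T n‖ ≤ K * cesaroNumber (α + 1) n) (N : ℕ) :
    binomialSum s T N * fracPow α T s = calculusReal α T (truncCoeff s N) := by
  have hS : ∀ j, Summable fun n => (weylDiffReal α (delayed s j) n : ℂ) • cesaroSum α T n :=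
    fun j => (summable_norm_weylDiffReal_smul hK0 hK
      (sum_abs_weylDiffReal_delayed_mul_le h0 h1.le hs0 hs1 j)).of_norm
  have h := hasSum_sum (s := Finset.range N) fun j _ =>
    (hS j).hasSum.const_smul (cesaroNumber s j : ℂ)
  rw [binomialSum, Finset.sum_mul, calculusReal]
  simp only [smul_mul_assoc, pow_mul_fracPow h0 h1 hs0 hs1 hK0 hK]
  refine h.tsum_eq.symm.trans (tsum_congr fun n => ?_)
  rw [weylDiffReal_truncCoeff h0 h1.le hs0 hs1, Complex.ofReal_sum, Finset.sum_smul]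
  exact Finset.sum_congr rfl fun j _ => by rw [Complex.ofReal_mul, smul_smul]

theorem exists_norm_binomialSum_mul_fracPow_le (h0 : 0 ≤ α) (hs0 : 0 < s) (hαs : α < 1 - s)
    (hK0 : 0 ≤ K) (hK : ∀ n, ‖cesaroSum α T n‖ ≤ K * cesaroNumber (α + 1) n) :
    ∃ C, ∀ N, ‖binomialSum s T N * fracPow α T s‖ ≤ C := by
  obtain ⟨C, hC⟩ := exists_sum_abs_weylDiffReal_truncCoeff_le h0 hs0 hαs
  refine ⟨K * C, fun N => ?_⟩
  rw [binomialSum_mul_fracPow h0 (by linarith) hs0.le (by linarith) hK0 hK]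
  exact norm_calculusReal_le hK0 hK (hC N)

/-- Operator form of (1-z)^{1-s} (1-z)^s = 1 - z. The double series converges absolutely because
k^{s-1}(j) k^{α+1}(j) = O(j^{s+α-2}) and s + α < 1. -/
theorem hasSum_cesaroNumber_smul_pow_mul_fracPow (h0 : 0 ≤ α) (hs0 : 0 < s) (hαs : α < 1 - s)
    (hK0 : 0 ≤ K) (hK : ∀ n, ‖cesaroSum α T n‖ ≤ K * cesaroNumber (α + 1) n) :
    HasSum (fun j => (cesaroNumber (s - 1) j : ℂ) • (T ^ j * fracPow α T s)) (1 - T) := by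
  have h1 : α < 1 := by linarith
  have hs1 : s ≤ 1 := by linarith
  have hsum : Summable fun p : ℕ × ℕ => (cesaroNumber (s - 1) p.1 : ℂ) •
      (weylDiffReal α (delayed s p.1) p.2 : ℂ) • cesaroSum α T p.2 := by
    refine Summable.of_norm_bounded (summable_prod_mul_of_sum_range_le
      (fun j => abs_nonneg (cesaroNumber (s - 1) j))
      (v := fun j n => ‖(weylDiffReal α (delayed s j) n : ℂ) • cesaroSum α T n‖)
      (c := fun j => K * (8 * cesaroNumber (α + 1) j)) (fun j m => norm_nonneg _)
      (fun j M => sum_norm_weylDiffReal_smul_le hK0 hK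
        (sum_abs_weylDiffReal_delayed_mul_le h0 h1.le hs0.le hs1 j) M) ?_) fun p => ?_
    · have := (summable_cesaroNumber_mul (a := s - 1) (b := α + 1) (by linarith)).mul_left (K * 8)
      refine this.congr fun j => ?_
      rw [abs_of_nonneg (cesaroNumber_nonneg (by linarith : 0 ≤ α + 1) j)]
      ring
    · rw [norm_smul, Complex.norm_real, Real.norm_eq_abs]
  have e : ∀ j, ∑' n, (cesaroNumber (s - 1) j : ℂ) •
      (weylDiffReal α (delayed s j) n : ℂ) • cesaroSum α T n =
      (cesaroNumber (s - 1) j : ℂ) • (T ^ j * fracPow α T s) := fun j => by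
    rw [pow_mul_fracPow h0 h1 hs0.le hs1 hK0 hK, calculusReal, tsum_const_smul'']
  have hS : Summable fun j => (cesaroNumber (s - 1) j : ℂ) • (T ^ j * fracPow α T s) :=
    hsum.prod.congr fun j => e j
  have hval : ∑' j, (cesaroNumber (s - 1) j : ℂ) • (T ^ j * fracPow α T s) = 1 - T := by
    rw [← tsum_congr e, Summable.tsum_comm
      (f := fun n j => (cesaroNumber (s - 1) j : ℂ) •
        (weylDiffReal α (delayed s j) n : ℂ) • cesaroSum α T n) hsum.prod_symm]
    have e2 : ∀ n, ∑' j, (cesaroNumber (s - 1) j : ℂ) •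
        (weylDiffReal α (delayed s j) n : ℂ) • cesaroSum α T n =
        ((delayed α n 0 - delayed α n 1 : ℝ) : ℂ) • cesaroSum α T n := fun n => by
      simp only [smul_smul, ← Complex.ofReal_mul]
      rw [← tsum_cesaroNumber_mul_weylDiffReal_delayed h0 h1.le hs0.le hs1, Complex.ofReal_tsum]
      refine Summable.tsum_smul_const (f := fun j => ((cesaroNumber (s - 1) j *
        weylDiffReal α (delayed s j) n : ℝ) : ℂ)) (Complex.ofRealCLM.summable ?_) _
      refine Summable.of_norm_bounded (g := fun j =>
        |cesaroNumber (s - 1) j| * |cesaroNumber (α + 1) j| * 8)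
        ((summable_cesaroNumber_mul (by linarith)).mul_right 8) fun j => ?_
      refine (norm_mul (cesaroNumber (s - 1) j) (weylDiffReal α (delayed s j) n)).le.trans ?_
      rw [Real.norm_eq_abs, Real.norm_eq_abs, mul_assoc]
      refine mul_le_mul_of_nonneg_left ?_ (abs_nonneg _)
      have h2 := sum_abs_weylDiffReal_delayed_mul_le h0 h1.le hs0.le hs1 j (n + 1)
      have hk : ∀ n, 1 ≤ cesaroNumber (α + 1) n := fun n => by
        simpa using monotone_cesaroNumber_add_one h0 (Nat.zero_le n)
      have h3 := Finset.single_le_sum (f := fun n =>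
        |weylDiffReal α (delayed s j) n| * cesaroNumber (α + 1) n)
        (fun n _ => mul_nonneg (abs_nonneg _) (zero_le_one.trans (hk n)))
        (Finset.self_mem_range_succ n)
      rw [abs_of_nonneg (zero_le_one.trans (hk j))]
      calc _ ≤ |weylDiffReal α (delayed s j) n| * cesaroNumber (α + 1) n :=
            le_mul_of_one_le_right (abs_nonneg _) (hk n)
        _ ≤ _ := h3.trans h2
        _ = _ := mul_comm _ _
    -- Only n = 0 and n = 1 survive, giving (1+α) I - (α I + T) = I - T.
    rw [tsum_congr e2, tsum_eq_sum (s := Finset.range 2)]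
    · simp [Finset.sum_range_succ, delayed, cesaroSum, cesaroNumber_one_right]
      module
    · intro n hn
      have : 1 < n := by simpa using hn
      rw [delayed_of_lt α (by omega), delayed_of_lt α this]
      simp
  exact hval ▸ hS.hasSum

theorem tendsto_binomialSum_mul_fracPow_mul (h0 : 0 ≤ α) (hs0 : 0 < s) (hαs : α < 1 - s)
    (hK0 : 0 ≤ K) (hK : ∀ n, ‖cesaroSum α T n‖ ≤ K * cesaroNumber (α + 1) n) :
    Tendsto (fun N => binomialSum s T N * fracPow α T s * (1 - T)) atTop (𝓝 (1 - T)) := by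
  have h1 : α < 1 := by linarith
  have hs1 : s ≤ 1 := by linarith
  have hk : ∀ n, 0 ≤ cesaroNumber (α + 1) n := cesaroNumber_nonneg (by linarith)
  rw [← tendsto_add_atTop_iff_nat 1]
  have e : ∀ N, binomialSum s T (N + 1) * fracPow α T s * (1 - T) =
      ∑ n ∈ Finset.range (N + 1), (cesaroNumber (s - 1) n : ℂ) • (T ^ n * fracPow α T s) -
        (cesaroNumber s N : ℂ) • (T ^ (N + 1) * fracPow α T s) := fun N => by
    have hc : Commute (fracPow α T s) (1 - T) :=
      (Commute.one_right _).sub_right (commute_fracPow h0 h1 hs0.le hs1 T).symm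
    rw [mul_assoc, hc.eq, ← mul_assoc, binomialSum_succ_mul_one_sub, sub_mul, Finset.sum_mul,
      smul_mul_assoc]
    simp only [smul_mul_assoc]
  have hA := (hasSum_cesaroNumber_smul_pow_mul_fracPow h0 hs0 hαs hK0 hK).tendsto_sum_nat.comp
    (tendsto_add_atTop_nat 1)
  -- The boundary term is O(N^{s+α-1}); 16 is the 8 of `norm_pow_mul_fracPow_le` times 2 for passing
  -- from N + 1 to N.
  have hB : Tendsto (fun N => (cesaroNumber s N : ℂ) • (T ^ (N + 1) * fracPow α T s)) atTop
      (𝓝 0) := by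
    have ht := (tendsto_cesaroNumber_mul_zero (a := s) (b := α + 1) (by linarith)).const_mul
      (16 * K)
    rw [mul_zero] at ht
    refine squeeze_zero_norm (fun N => ?_) ht
    rw [norm_smul, Complex.norm_real, Real.norm_eq_abs, abs_of_nonneg (hk N)]
    calc _ ≤ |cesaroNumber s N| * (8 * K * (2 * cesaroNumber (α + 1) N)) := by
          refine mul_le_mul_of_nonneg_left ?_ (abs_nonneg _)
          refine (norm_pow_mul_fracPow_le h0 h1 hs0.le hs1 hK0 hK (N + 1)).trans ?_
          exact mul_le_mul_of_nonneg_left (cesaroNumber_add_one_succ_le h0 h1.le N)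
            (by positivity)
      _ = _ := by ring
  have := hA.sub hB
  rw [sub_zero] at this
  exact this.congr fun N => (e N).symm

theorem tendsto_binomialSum_fracPow_apply (h0 : 0 ≤ α) (hs0 : 0 < s) (hαs : α < 1 - s)
    (hT : IsCesaroBounded α T) (hdense : DenseRange fun x : X => x - T x) (x : X) :
    Tendsto (fun N => binomialSum s T N (fracPow α T s x)) atTop (𝓝 x) := by
  obtain ⟨K, hK0, hK⟩ := hT.exists_norm_cesaroSum_le h0
  obtain ⟨C, hC⟩ := exists_norm_binomialSum_mul_fracPow_le h0 hs0 hαs hK0 hK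
  refine tendsto_apply_of_dense (L := fun N => binomialSum s T N * fracPow α T s) hC hdense ?_ x
  rintro _ ⟨y, rfl⟩
  exact ((ContinuousLinearMap.apply ℂ X y).continuous.tendsto _).comp
    (tendsto_binomialSum_mul_fracPow_mul h0 hs0 hαs hK0 hK)

theorem injective_fracPow (h0 : 0 ≤ α) (hs0 : 0 < s) (hαs : α < 1 - s)
    (hT : IsCesaroBounded α T) (hdense : DenseRange fun x : X => x - T x) :
    Function.Injective (fracPow α T s) := fun x y hxy => by
  have hx := tendsto_binomialSum_fracPow_apply h0 hs0 hαs hT hdense x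
  rw [hxy] at hx
  exact tendsto_nhds_unique hx (tendsto_binomialSum_fracPow_apply h0 hs0 hαs hT hdense y)

/-- The difference between the series `∑ n^{s-1} T^n x` and `Γ(s) ∑ k^s(n) T^n x` is absolutely
convergent. -/
theorem summable_rpow_sub_smul (h0 : 0 ≤ α) (hs0 : 0 < s) (hαs : α < 1 - s)
    (hT : IsCesaroBounded α T) (x : X) :
    Summable fun n : ℕ => (((1 / ((n + 1 : ℕ) : ℝ) ^ (1 - s) -
      Real.Gamma s * cesaroNumber s (n + 1) : ℝ)) : ℂ) • (T ^ (n + 1)) x := by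
  obtain ⟨K, hK0, hK⟩ := hT.exists_norm_cesaroSum_le h0
  obtain ⟨D, hD0, hD⟩ := exists_abs_cesaroNumber_le (α + 1)
  have hs : Summable fun n : ℕ => (2 * K * D * ‖x‖) * ((n + 1 : ℕ) : ℝ) ^ (s - 2 + α) :=
    ((summable_nat_add_iff 1).2 (Real.summable_nat_rpow.2
      (by linarith : s - 2 + α < -1))).mul_left _
  refine Summable.of_norm_bounded hs fun n => ?_
  have hn : (0 : ℝ) < (n + 1 : ℕ) := by positivity
  rw [norm_smul, Complex.norm_real, Real.norm_eq_abs]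
  have e : 1 / ((n + 1 : ℕ) : ℝ) ^ (1 - s) = ((n + 1 : ℕ) : ℝ) ^ (s - 1) := by
    rw [one_div, ← Real.rpow_neg hn.le, neg_sub]
  rw [e, Real.rpow_add hn]
  have hp : ‖T ^ (n + 1)‖ ≤ 2 * K * (D * ((n + 1 : ℕ) : ℝ) ^ α) := by
    refine (norm_pow_le h0 (by linarith) hK0 hK (n + 1)).trans
      (mul_le_mul_of_nonneg_left ?_ (by positivity))
    simpa using (le_abs_self _).trans (hD (n + 1) (Nat.succ_pos n))
  calc _ ≤ ((n + 1 : ℕ) : ℝ) ^ (s - 2) * (2 * K * (D * ((n + 1 : ℕ) : ℝ) ^ α) * ‖x‖) := by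
        gcongr
        · exact abs_rpow_sub_Gamma_mul_cesaroNumber_le hs0 (by linarith) (Nat.succ_pos n)
        · exact (T ^ (n + 1)).le_of_opNorm_le hp x
    _ = _ := by ring

end CesaroBounded

end

/-! ### The equivalences and the inversion formula. -/

theorem theorem8p3 {X : Type*} [NormedAddCommGroup X] [NormedSpace ℂ X] [CompleteSpace X]
    (s α : ℝ) (hs0 : 0 < s) (hs1 : s < 1) (hα0 : 0 ≤ α) (hα1 : α < 1 - s)
    (T : X →L[ℂ] X) (hT : CesaroBounded.IsCesaroBounded α T)
    (hdense : DenseRange (fun x : X => x - T x)) :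
    Function.Injective (CesaroBounded.fracPow α T s) ∧
    ∀ x : X,
      [x ∈ Set.range (CesaroBounded.fracPow α T s),
        ∃ y : X, Tendsto
          (fun N : ℕ => ∑ n ∈ Finset.Icc 1 N, ((1 / (n : ℝ) ^ (1 - s) : ℝ) : ℂ) • (T ^ n) x)
          atTop (𝓝 y),
        ∃ y : X, Tendsto
          (fun N : ℕ => toWeakSpace ℂ X
            (∑ n ∈ Finset.Icc 1 N, ((1 / (n : ℝ) ^ (1 - s) : ℝ) : ℂ) • (T ^ n) x))
          atTop (𝓝 (toWeakSpace ℂ X y))].TFAE ∧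
      (x ∈ Set.range (CesaroBounded.fracPow α T s) →
        ∃ hx : x ∈ (CesaroBounded.negFracPow α T s).domain,
          Tendsto
            (fun N : ℕ => ∑ n ∈ Finset.range N, (CesaroBounded.cesaroNumber s n : ℂ) • (T ^ n) x)
            atTop (𝓝 (CesaroBounded.negFracPow α T s ⟨x, hx⟩))) := by
  have hinj := CesaroBounded.injective_fracPow hα0 hs0 hα1 hT hdense
  have hlim := CesaroBounded.tendsto_binomialSum_fracPow_apply hα0 hs0 hα1 hT hdense
  refine ⟨hinj, fun x => ⟨?_, ?_⟩⟩
  · have hE := (CesaroBounded.summable_rpow_sub_smul hα0 hs0 hα1 hT x).hasSum.tendsto_sum_nat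
    simp only [CesaroBounded.sum_Icc_smul_pow_apply]
    tfae_have 1 → 2 := by
      rintro ⟨y, rfl⟩
      exact ⟨_, ((((hlim y).comp (tendsto_add_atTop_nat 1)).sub_const _).const_smul _).add hE⟩
    tfae_have 2 → 3 := fun ⟨y, hy⟩ =>
      ⟨y, ((toWeakSpaceCLM ℂ X).continuous.tendsto y).comp hy⟩
    tfae_have 3 → 1 := by
      rintro ⟨y, hy⟩
      have hG : (Real.Gamma s : ℂ) ≠ 0 :=
        Complex.ofReal_ne_zero.2 (Real.Gamma_pos_of_pos hs0).ne'
      have hE' := ((toWeakSpaceCLM ℂ X).continuous.tendsto _).comp hE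
      -- Removing the convergent error, dividing by Γ(s) and restoring the n = 0 term x turns the
      -- hypothesis into weak convergence of the binomial sums.
      have hS := ((hy.sub hE').const_smul (Real.Gamma s : ℂ)⁻¹).add_const (toWeakSpace ℂ X x)
      have hw := hS.congr
          (f₂ := fun N => toWeakSpace ℂ X (CesaroBounded.binomialSum s T (N + 1) x)) fun N => by
        change _ • (_ - toWeakSpace ℂ X _) + _ = _
        rw [← map_sub, add_sub_cancel_right, map_smul, inv_smul_smul₀ hG, ← map_add,
          sub_add_cancel]
      -- (I-T)^s is weakly continuous and commutes with the binomial sums; uniqueness of weak limits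
      -- identifies x with the image of their limit.
      have hA := ((WeakSpace.map (CesaroBounded.fracPow α T s)).continuous.tendsto _).comp hw
      have hx := ((toWeakSpaceCLM ℂ X).continuous.tendsto x).comp
        ((hlim x).comp (tendsto_add_atTop_nat 1))
      refine ⟨_, (toWeakSpace ℂ X).injective (tendsto_nhds_unique hA (hx.congr fun N => ?_))⟩
      exact congrArg (toWeakSpace ℂ X) (DFunLike.congr_fun
        (CesaroBounded.commute_binomialSum_fracPow hα0 (by linarith) hs0.le hs1.le T
          (N + 1)).eq x)
    tfae_finish
  · rintro ⟨y, rfl⟩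
    have hx : CesaroBounded.fracPow α T s y ∈ (CesaroBounded.negFracPow α T s).domain := by
      rw [CesaroBounded.negFracPow, LinearPMap.inverse_domain]
      exact ⟨⟨y, Submodule.mem_top⟩, rfl⟩
    refine ⟨hx, ?_⟩
    have hy : CesaroBounded.negFracPow α T s ⟨_, hx⟩ = y := by
      refine LinearPMap.inverse_apply_eq (x := ⟨y, Submodule.mem_top⟩) ?_ rfl
      rw [LinearMap.ker_eq_bot]
      exact fun a b hab => Subtype.ext (hinj hab)
    rw [hy]
    refine (hlim y).congr fun N => ?_
    simp [CesaroBounded.binomialSum]
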